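/- A finite poset is $(\mathbf{2+2})$-free if it has no induced subposet isomorphic to the disjoint union of two $2$-element chains. For $n\ge 0$ let $p_n$ be the number of isomorphism classes of $(\mathbf{2+2})$-free posets on $n$ elements. Then, as an identity of formal power series in $\mathbb{Z}[[t]]$ (the sum on the right converging coefficientwise), $$P(t)=\sum_{n\ge 0}p_n\,t^n=\sum_{n\ge 0}\ \prod_{i=1}^n\bigl(1-(1-t)^i\bigr).$$ Moreover, for every $n\ge 0$, $p_n$ is also equal to each of the following numbers: (a) the number of ascent sequences of length $n$, that is, of sequences $(x_1,\dots,x_n)$ of nonnegative integers with $x_1=0$ (if $n\ge1$) and $0\le x_i\le 1+|\{1\le j<i-1 : x_j<x_{j+1}\}|$ for $2\le i\le n$; (b) the number of permutations in $\mathcal{R}_n$, that is, of permutations $\pi_1\cdots\pi_n$ of $\{1,\dots,n\}$ for which there are no indices $i<j<k$ with $\pi_k<\pi_i<\pi_j$, $j=i+1$ and $\pi_i=\pi_k+1$; (c) the number of Stoimenow's regular linearized chord diagrams on $2n$ points, that is, of fixed point free involutions $\pi$ of $\{1,\dots,2n\}$ such that $\pi_i>\pi_{i+1}$ implies $\pi_i>i\ge\pi_{i+1}$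 (this is Zagier's enumeration). -/

import Mathlib

open scoped PowerSeries.WithPiTopology

namespace Fishburn

/-! ### Unlabeled (2+2)-free posets -/

/-- A poset is (2+2)-free if it has no induced subposet isomorphic to the disjoint union of two
2-element chains (Mathlib's order on `α ⊕ β` is the disjoint union: elements of different summands
are incomparable). -/
def TwoPlusTwoFree (α : Type*) [PartialOrder α] : Prop :=
  IsEmpty ((Fin 2 ⊕ Fin 2) ↪o α)

/-- The (2+2)-free partial orders on the labeled set `Fin n`. -/
def LabeledPoset (n : ℕ) : Type :=
  {P : PartialOrder (Fin n) // @TwoPlusTwoFree (Fin n) P}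

/-- Isomorphism of posets. -/
def posetSetoid (n : ℕ) : Setoid (LabeledPoset n) where
  r P Q := Nonempty (P.1.le ≃r Q.1.le)
  iseqv :=
    { refl := fun P => ⟨RelIso.refl P.1.le⟩
      symm := fun ⟨e⟩ => ⟨e.symm⟩
      trans := fun ⟨e⟩ ⟨f⟩ => ⟨e.trans f⟩ }

/-- Unlabeled (2+2)-free posets on `n` elements: isomorphism classes. -/
def UnlabeledPoset (n : ℕ) : Type :=
  Quotient (posetSetoid n)

/-! ### Ascent sequences -/

/-- The number of ascents of a sequence. -/
noncomputable def asc {k : ℕ} (x : Fin k → ℕ) : ℕ :=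
  Nat.card {j : Fin k // ∃ h : (j : ℕ) + 1 < k, x j < x ⟨(j : ℕ) + 1, h⟩}

/-- `x` is an ascent sequence: the first entry is `0`, and every later entry is at most one more
than the number of ascents of the sequence of entries before it. -/
def IsAscentSequence {n : ℕ} (x : Fin n → ℕ) : Prop :=
  ∀ i : Fin n,
    ((i : ℕ) = 0 → x i = 0) ∧
    (0 < (i : ℕ) → x i ≤ 1 + asc (fun j : Fin (i : ℕ) => x (Fin.castLE i.isLt.le j)))

/-! ### Pattern-avoiding permutations -/

/-- `π i π j π k` (with `i < j < k`) being order-isomorphic to `231` forces `j ≠ i + 1` or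
`π i ≠ π k + 1`. -/
def IsR {n : ℕ} (π : Equiv.Perm (Fin n)) : Prop :=
  ∀ i j k : Fin n, i < j → j < k → π k < π i → π i < π j →
    (j : ℕ) ≠ (i : ℕ) + 1 ∨ (π i : ℕ) ≠ (π k : ℕ) + 1

/-! ### Regular linearized chord diagrams -/

/-- A fixed point free involution in which every descent crosses the main diagonal:
if `π i > π (i + 1)` then `π i > i ≥ π (i + 1)`. -/
def IsRegularChordDiagram {m : ℕ} (π : Equiv.Perm (Fin m)) : Prop :=
  (∀ i, π (π i) = i) ∧ (∀ i, π i ≠ i) ∧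
    ∀ i j : Fin m, (j : ℕ) = (i : ℕ) + 1 → π j < π i → i < π i ∧ π j ≤ i

/-! ### Generating functions -/

/-- The generating function of unlabeled (2+2)-free posets by number of elements. -/
noncomputable def posetSeries : PowerSeries ℤ :=
  PowerSeries.mk fun n => (Nat.card (UnlabeledPoset n) : ℤ)

/-- The generating function of ascent sequences by length. -/
noncomputable def ascentSeries : PowerSeries ℤ :=
  PowerSeries.mk fun n => (Nat.card {x : Fin n → ℕ // IsAscentSequence x} : ℤ)

/-- The generating function of the permutations in `R_n` by length. -/
noncomputable def permSeries : PowerSeries ℤ :=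
  PowerSeries.mk fun n => (Nat.card {π : Equiv.Perm (Fin n) // IsR π} : ℤ)

/-- The generating function of regular linearized chord diagrams on `2n` points by the number `n`
of chords. -/
noncomputable def chordSeries : PowerSeries ℤ :=
  PowerSeries.mk fun n =>
    (Nat.card {π : Equiv.Perm (Fin (2 * n)) // IsRegularChordDiagram π} : ℤ)

end Fishburn

/-! Write q = 1 - t and (q)_k = ∏_{i ≤ k} (1 - q^i). Since t^k divides (q)_k, a power series is
determined by its congruence with ∑_{k<N} (q)_k modulo t^N for every N. The four families fall into
two pairs, and each pair is shown to satisfy these congruences.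

Ascent sequences and the permutations in R_n share a generating tree whose nodes carry labels (a,
l). For a sequence, a is the number of ascents and l the last entry. A permutation grows by
insertion of a new largest value; a is the number of ascents of its inverse, and l counts the active
sites to the left of the one just before the largest value. The series T(a, l) of the tree obeys a
linear recursion with an explicit solution: put A = 1/(1 - x), B = 1/(1 - qx), and let Λ be the
functional x^k ↦ (q)_k q^{-k}, truncated at N. Then Λ(A^{a+1-l} B^l) satisfies the recursion of q
T(a, l) up to an error divisible by t^N (`pochFunctional_rec`). The root gives Λ(A) = ∑ (q)_k
q^{-k}, and a telescoping sum turns this into ∑ (q)_k.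

Posets and chord diagrams are both encoded by multisets of intervals whose left ends, and also whose
right ends, fill 0, …, m - 1. The strict down-sets of a (2+2)-free poset form a chain, which yields
such a representation; it is unique (`TwoPlusTwoFree.isRep`, `IsRep.unique`). A regular diagram is
increasing along each stretch of openers and each stretch of closers, so it is recovered from the
runs joined by its chords (`IsRegularChordDiagram.exists_equiv`). Multiplicities turn interval
multisets into upper triangular matrices without zero rows or columns. Inclusion-exclusion on the
rows gives a recursion whose iteration again produces ∑ (q)_k. -/

namespace Fishburn

open PowerSeries Finset

/-! ### The generating tree -/

/-- The number of nodes at depth `k` below a node with label `(a, l)` in the generating tree in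
which a node `(a, l)` has children with second label `l' = 0, …, a + 1`, the first label growing by
one exactly when `l < l'`. -/
def treeCount : ℕ → ℕ → ℕ → ℕ
  | 0, _, _ => 1
  | k + 1, a, l => ∑ l' ∈ range (a + 2), treeCount k (if l' ≤ l then a else a + 1) l'

/-- The generating function of the nodes below `(a, l)` by depth. -/
noncomputable def treeSeries (a l : ℕ) : ℤ⟦X⟧ :=
  PowerSeries.mk fun k => (treeCount k a l : ℤ)

theorem treeSeries_eq (a l : ℕ) :
    treeSeries a l =
      1 + X * ∑ l' ∈ range (a + 2), treeSeries (if l' ≤ l then a else a + 1) l' := by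
  ext n
  cases n with
  | zero => simp [treeSeries, treeCount]
  | succ n => simp [treeSeries, treeCount, coeff_succ_X_mul, coeff_one]

/-! ### Solving the tree recursion by a linear functional -/

/-- The base `1 - t` of the `q`-Pochhammer symbols. -/
noncomputable def qBase : ℤ⟦X⟧ := 1 - X

/-- The inverse of `1 - t`. -/
noncomputable def qInv : ℤ⟦X⟧ := PowerSeries.mk 1

theorem qInv_mul_qBase : qInv * qBase = 1 := PowerSeries.mk_one_mul_one_sub_eq_one ℤ

/-- The product `∏_{i=1}^n (1 - (1 - t)^i)`. -/
noncomputable def qPoch (n : ℕ) : ℤ⟦X⟧ := ∏ i ∈ Icc 1 n, (1 - qBase ^ i)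

theorem qPoch_zero : qPoch 0 = 1 := by simp [qPoch]

theorem qPoch_succ (n : ℕ) : qPoch (n + 1) = qPoch n * (1 - qBase ^ (n + 1)) := by
  simp [qPoch, Finset.prod_Icc_succ_top]

theorem X_dvd_one_sub_qBase_pow (n : ℕ) : (X : ℤ⟦X⟧) ∣ 1 - qBase ^ n := by
  rw [X_dvd_iff]; simp [qBase]

theorem X_pow_dvd_qPoch (n : ℕ) : (X : ℤ⟦X⟧) ^ n ∣ qPoch n := by
  induction n with
  | zero => simp
  | succ n ih =>
    rw [qPoch_succ, pow_succ]; exact mul_dvd_mul ih (X_dvd_one_sub_qBase_pow _)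

/-- The power series `1 / (1 - x)` over `ℤ⟦t⟧`. -/
noncomputable def geomOne : ℤ⟦X⟧⟦X⟧ := PowerSeries.mk 1

/-- The power series `1 / (1 - (1 - t) x)` over `ℤ⟦t⟧`. -/
noncomputable def geomQ : ℤ⟦X⟧⟦X⟧ := rescale qBase geomOne

theorem geomOne_mul : geomOne * (1 - X) = 1 := PowerSeries.mk_one_mul_one_sub_eq_one _

theorem geomQ_mul : geomQ * (1 - C qBase * X) = 1 := by
  have h := congrArg (rescale qBase) geomOne_mul
  simpa [rescale_X, geomQ] using h

/-- The truncated linear functional `f ↦ ∑_{k < N} (q)_k q⁻ᵏ [xᵏ] f`. -/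
noncomputable def pochFunctional (N : ℕ) (f : ℤ⟦X⟧⟦X⟧) : ℤ⟦X⟧ :=
  ∑ k ∈ range N, qPoch k * qInv ^ k * coeff k f

theorem pochFunctional_add (N : ℕ) (f g : ℤ⟦X⟧⟦X⟧) :
    pochFunctional N (f + g) = pochFunctional N f + pochFunctional N g := by
  simp [pochFunctional, mul_add, sum_add_distrib]

theorem pochFunctional_C_mul (N : ℕ) (r : ℤ⟦X⟧) (f : ℤ⟦X⟧⟦X⟧) :
    pochFunctional N (C r * f) = r * pochFunctional N f := by
  simp only [pochFunctional, coeff_C_mul, mul_sum]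
  exact sum_congr rfl fun _ _ => by ring

theorem pochFunctional_sum (N : ℕ) {ι : Type*} (s : Finset ι) (f : ι → ℤ⟦X⟧⟦X⟧) :
    pochFunctional N (∑ i ∈ s, f i) = ∑ i ∈ s, pochFunctional N (f i) := by
  simp only [pochFunctional, map_sum, mul_sum]
  exact sum_comm

/-- With A = `geomOne` and B = `geomQ`, one has A - B = t x A B, so the sum is (A^{a+2} - B^{a+2}) /
(t x A B). -/
theorem X_mul_geom_sum (a : ℕ) :
    (X : ℤ⟦X⟧⟦X⟧) * (C X * ∑ l ∈ range (a + 2), geomOne ^ (a + 1 - l) * geomQ ^ l) =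
      (1 - C qBase * X) * geomOne ^ (a + 1) - (1 - X) * geomQ ^ (a + 1) := by
  have h1 := geomOne_mul
  have h2 := geomQ_mul
  have hC : (C (X : ℤ⟦X⟧) : ℤ⟦X⟧⟦X⟧) = 1 - C qBase := by simp [qBase]
  have hg := (Commute.all geomQ geomOne).geom_sum₂_mul (a + 2)
  have hS : ∑ l ∈ range (a + 2), geomOne ^ (a + 1 - l) * geomQ ^ l =
      ∑ i ∈ range (a + 2), geomQ ^ i * geomOne ^ (a + 2 - 1 - i) :=
    sum_congr rfl fun l _ => by rw [mul_comm]; rfl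
  rw [← hS] at hg
  set S := ∑ l ∈ range (a + 2), geomOne ^ (a + 1 - l) * geomQ ^ l
  rw [hC]
  have hu : geomOne ^ (a + 2) * ((1 - X) * (1 - C qBase * X)) =
      (1 - C qBase * X) * geomOne ^ (a + 1) := by
    rw [pow_succ]; linear_combination (geomOne ^ (a + 1) * (1 - C qBase * X)) * h1
  have hw : geomQ ^ (a + 2) * ((1 - X) * (1 - C qBase * X)) =
      (1 - X) * geomQ ^ (a + 1) := by
    rw [pow_succ]; linear_combination (geomQ ^ (a + 1) * (1 - X)) * h2
  linear_combination (-(1 - X) * (1 - C qBase * X)) * hg + hu - hw +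
    S * (1 - X) * h2 - S * (1 - C qBase * X) * h1

theorem coeff_geomQ_pow (k a : ℕ) :
    coeff k (geomQ ^ a) = qBase ^ k * coeff k (geomOne ^ a) := by
  rw [geomQ, ← map_pow, coeff_rescale]

theorem coeff_geomOne_zero (a : ℕ) : coeff 0 (geomOne ^ a) = 1 := by
  simp [geomOne]

theorem coeff_one_sub_C_mul_X_mul (r : ℤ⟦X⟧) (f : ℤ⟦X⟧⟦X⟧) (k : ℕ) :
    coeff (k + 1) ((1 - C r * X) * f) = coeff (k + 1) f - r * coeff k f := by
  rw [sub_mul, one_mul, map_sub, mul_assoc, coeff_C_mul, coeff_succ_X_mul]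

/-- The weights (q)_k q^{-k} are chosen for this telescoping: as [x^k] B^{a+1} = q^k [x^k] A^{a+1},
the k-th term equals g_k - g_{k+1} with g_k = q (q)_k q^{-k} [x^k] A^{a+1}. The leftover g_N is
divisible by t^N. -/
theorem pochFunctional_boundary (N a : ℕ) :
    pochFunctional N (geomQ ^ (a + 1) -
        C X * ∑ l ∈ range (a + 2), geomOne ^ (a + 1 - l) * geomQ ^ l) =
      qBase - qBase * (qPoch N * qInv ^ N * coeff N (geomOne ^ (a + 1))) := by
  have key : ∀ k, qPoch k * qInv ^ k * coeff k (geomQ ^ (a + 1) -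
      C X * ∑ l ∈ range (a + 2), geomOne ^ (a + 1 - l) * geomQ ^ l) =
      qBase * (qPoch k * qInv ^ k * coeff k (geomOne ^ (a + 1))) -
      qBase * (qPoch (k + 1) * qInv ^ (k + 1) * coeff (k + 1) (geomOne ^ (a + 1))) := by
    intro k
    have h := congrArg (coeff (k + 1)) (X_mul_geom_sum a)
    have h1 : (1 - X : ℤ⟦X⟧⟦X⟧) = 1 - C 1 * X := by simp
    rw [coeff_succ_X_mul, map_sub, h1, coeff_one_sub_C_mul_X_mul, coeff_one_sub_C_mul_X_mul,
      coeff_geomQ_pow, coeff_geomQ_pow] at h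
    rw [map_sub, h, coeff_geomQ_pow, qPoch_succ]
    have hq := qInv_mul_qBase
    rw [pow_succ qInv]
    linear_combination ((qPoch k * (1 - qBase ^ (k + 1)) * qInv ^ k *
      coeff (k + 1) (geomOne ^ (a + 1)))) * hq
  rw [pochFunctional, sum_congr rfl fun k _ => key k, Finset.sum_range_sub']
  rw [coeff_geomOne_zero, qPoch_zero]
  simp

/-- Up to the factor A^{a-l} B^l this is t A B = A - B + t B. -/
theorem geom_step (a l : ℕ) (hl : l < a + 1) :
    C X * (geomOne ^ (a + 1 - l) * geomQ ^ (l + 1)) =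
      geomOne ^ (a + 1 - l) * geomQ ^ l - geomOne ^ (a + 1 - (l + 1)) * geomQ ^ (l + 1) +
      C X * (geomOne ^ (a + 1 - (l + 1)) * geomQ ^ (l + 1)) := by
  obtain ⟨b, rfl⟩ : ∃ b, a = l + b := ⟨a - l, by omega⟩
  have e1 : l + b + 1 - l = b + 1 := by omega
  have e2 : l + b + 1 - (l + 1) = b := by omega
  have hC : (C (X : ℤ⟦X⟧) : ℤ⟦X⟧⟦X⟧) = 1 - C qBase := by simp [qBase]
  rw [e1, e2, hC, pow_succ, pow_succ]
  have h1 := geomOne_mul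
  have h2 := geomQ_mul
  linear_combination (-C qBase * geomOne ^ b * geomQ ^ l * geomQ) * h1 +
    geomOne ^ b * geomQ ^ l * geomOne * h2

/-- Downward induction on l. At l = a + 1 no child raises the first label; passing from l + 1 to l
changes only the child l' = l + 1, and `geom_step` is exactly that change. -/
theorem sum_geom_step (a l : ℕ) (hl : l ≤ a + 1) :
    C X * ∑ l' ∈ range (a + 2), geomOne ^ ((if l' ≤ l then a else a + 1) + 1 - l') * geomQ ^ l' =
      geomOne ^ (a + 1 - l) * geomQ ^ l - geomQ ^ (a + 1) +
      C X * ∑ l' ∈ range (a + 2), geomOne ^ (a + 1 - l') * geomQ ^ l' := by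
  induction hl using Nat.decreasingInduction with
  | self =>
    have : ∀ l' ∈ range (a + 2), geomOne ^ ((if l' ≤ a + 1 then a else a + 1) + 1 - l') *
        geomQ ^ l' = geomOne ^ (a + 1 - l') * geomQ ^ l' := fun l' h => by
      rw [if_pos (by have := mem_range.1 h; omega)]
    rw [sum_congr rfl this]; simp
  | of_succ l hl ih =>
    have hm : l + 1 ∈ range (a + 2) := by simp; omega
    rw [← add_sum_erase _ _ hm] at ih ⊢
    have : ∀ l' ∈ (range (a + 2)).erase (l + 1),
        geomOne ^ ((if l' ≤ l then a else a + 1) + 1 - l') * geomQ ^ l' =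
        geomOne ^ ((if l' ≤ l + 1 then a else a + 1) + 1 - l') * geomQ ^ l' := fun l' h => by
      have h' := (mem_erase.1 h).1
      by_cases h2 : l' ≤ l
      · rw [if_pos h2, if_pos (by omega)]
      · rw [if_neg h2, if_neg (by omega)]
    rw [sum_congr rfl this]
    have hs := geom_step a l hl
    rw [if_pos le_rfl] at ih
    rw [if_neg (by omega), show a + 1 + 1 - (l + 1) = a + 1 - l by omega]
    linear_combination ih + hs

theorem pochFunctional_rec (N a l : ℕ) (hl : l ≤ a + 1) :
    pochFunctional N (geomOne ^ (a + 1 - l) * geomQ ^ l) =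
      qBase - qBase * (qPoch N * qInv ^ N * coeff N (geomOne ^ (a + 1))) +
      X * ∑ l' ∈ range (a + 2), pochFunctional N
        (geomOne ^ ((if l' ≤ l then a else a + 1) + 1 - l') * geomQ ^ l') := by
  rw [← pochFunctional_boundary, ← pochFunctional_sum, ← pochFunctional_C_mul,
    ← pochFunctional_add, sum_geom_step a l hl]
  congr 1; ring

/-- Both terms obey the same recursion up to an error divisible by t^N, and each unfolding puts a
factor t in front of the differences at the children. -/
theorem X_pow_dvd_pochFunctional_sub (N n : ℕ) (hn : n ≤ N) : ∀ a l : ℕ, l ≤ a + 1 →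
    (X : ℤ⟦X⟧) ^ n ∣ pochFunctional N (geomOne ^ (a + 1 - l) * geomQ ^ l) -
      qBase * treeSeries a l := by
  induction n with
  | zero => simp
  | succ n ih =>
    intro a l hl
    have hN : (X : ℤ⟦X⟧) ^ (n + 1) ∣ qPoch N := (pow_dvd_pow _ hn).trans (X_pow_dvd_qPoch N)
    have e : pochFunctional N (geomOne ^ (a + 1 - l) * geomQ ^ l) - qBase * treeSeries a l =
        X * ∑ l' ∈ range (a + 2), (pochFunctional N
          (geomOne ^ ((if l' ≤ l then a else a + 1) + 1 - l') * geomQ ^ l') -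
          qBase * treeSeries (if l' ≤ l then a else a + 1) l') -
        qPoch N * (qBase * (qInv ^ N * coeff N (geomOne ^ (a + 1)))) := by
      rw [pochFunctional_rec N a l hl, treeSeries_eq a l, sum_sub_distrib, ← mul_sum]
      ring
    rw [e]
    refine dvd_sub ?_ (hN.mul_right _)
    rw [pow_succ']
    refine mul_dvd_mul_left _ (dvd_sum fun l' h => ih (by omega) _ _ ?_)
    have := mem_range.1 h
    split_ifs <;> omega

/-- Converts the root value ∑ (q)_k q^{-k} of the functional into ∑ (q)_k; the discrepancy
telescopes. -/
theorem X_mul_sum_qPoch (N : ℕ) :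
    X * ∑ k ∈ range N, qPoch k * qInv ^ k =
      qBase * (∑ k ∈ range N, qPoch k) - qBase + qBase * (qPoch N * qInv ^ N) := by
  induction N with
  | zero => simp [qPoch_zero]
  | succ N ih =>
    rw [sum_range_succ, sum_range_succ, mul_add, ih, qPoch_succ]
    have hq := qInv_mul_qBase
    have hp : qInv ^ N * qBase ^ N = 1 := by rw [← mul_pow, hq, one_pow]
    have hX : (X : ℤ⟦X⟧) = 1 - qBase := by simp [qBase]
    rw [hX, pow_succ, pow_succ]
    linear_combination -(qPoch N * qInv ^ N * (1 - qBase ^ N * qBase)) * hq + qPoch N * qBase * hp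

/-- The generating function of the generating tree is the `q`-series, to any order. -/
theorem X_pow_dvd_treeSeries_sub (N : ℕ) :
    (X : ℤ⟦X⟧) ^ N ∣ 1 + X * treeSeries 0 0 - ∑ k ∈ range N, qPoch k := by
  have h := X_pow_dvd_pochFunctional_sub N N le_rfl 0 0 (by omega)
  -- At the root the monomial is A alone, all of whose coefficients are 1.
  have e : pochFunctional N (geomOne ^ (0 + 1 - 0) * geomQ ^ 0) =
      ∑ k ∈ range N, qPoch k * qInv ^ k := by
    simp [pochFunctional, geomOne]
  rw [e] at h
  have h2 : 1 + X * treeSeries 0 0 - ∑ k ∈ range N, qPoch k =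
      qPoch N * qInv ^ N - qInv * X * (∑ k ∈ range N, qPoch k * qInv ^ k -
        qBase * treeSeries 0 0) := by
    have hs := X_mul_sum_qPoch N
    have hq := qInv_mul_qBase
    linear_combination qInv * hs - (X * treeSeries 0 0 - ∑ k ∈ range N, qPoch k + 1 -
      qPoch N * qInv ^ N) * hq
  rw [h2]
  exact dvd_sub ((X_pow_dvd_qPoch N).mul_right _) (h.mul_left _)

/-! ### Ascent sequences in the generating tree -/

/-- Counting by a generating tree: if the objects of size `n + 1` are the children of those of
size `n` and the labels follow the rule of `treeCount`, then the `k`-th descendants are counted by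
`treeCount k`. -/
theorem card_eq_sum_treeCount {Y : ℕ → Type} [∀ n, Fintype (Y n)] (a l : ∀ n, Y n → ℕ)
    (e : ∀ n, Y (n + 1) ≃ Σ y : Y n, Fin (a n y + 2))
    (hl : ∀ n y, l (n + 1) y = (e n y).2)
    (ha : ∀ n y, a (n + 1) y =
      if ((e n y).2 : ℕ) ≤ l n (e n y).1 then a n (e n y).1 else a n (e n y).1 + 1) (k : ℕ) :
    ∀ n, Nat.card (Y (n + k)) = ∑ y : Y n, treeCount k (a n y) (l n y) := by
  induction k with
  | zero => intro n; simp [treeCount]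
  | succ k ih =>
    intro n
    have h := ih (n + 1)
    rw [show n + 1 + k = n + (k + 1) by ring] at h
    rw [h, ← (e n).symm.sum_comp, Fintype.sum_sigma]
    refine sum_congr rfl fun y _ => ?_
    rw [treeCount, ← Fin.sum_univ_eq_sum_range
      (fun l' => treeCount k (if l' ≤ l n y then a n y else a n y + 1) l')]
    refine sum_congr rfl fun j _ => ?_
    rw [hl, ha, Equiv.apply_symm_apply]

theorem asc_eq_sum {n : ℕ} (x : Fin (n + 1) → ℕ) :
    asc x = ∑ j : Fin n, if x j.castSucc < x j.succ then 1 else 0 := by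
  have e : {j : Fin (n + 1) // ∃ h : (j : ℕ) + 1 < n + 1, x j < x ⟨(j : ℕ) + 1, h⟩} ≃
      {j : Fin n // x j.castSucc < x j.succ} :=
    { toFun := fun j => ⟨⟨j.1, by have := j.2.1; omega⟩, j.2.2⟩
      invFun := fun j => ⟨j.1.castSucc, by simp, j.2⟩
      left_inv := fun j => rfl
      right_inv := fun j => rfl }
  rw [asc, Nat.card_congr e, Nat.card_eq_fintype_card, Fintype.card_subtype, card_filter]

theorem asc_succ {n : ℕ} (x : Fin (n + 2) → ℕ) :
    asc x = asc (Fin.init x) +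
      if x (Fin.last n).castSucc < x (Fin.last (n + 1)) then 1 else 0 := by
  rw [asc_eq_sum, asc_eq_sum, Fin.sum_univ_castSucc]
  rfl

theorem isAscentSequence_succ {n : ℕ} (x : Fin (n + 2) → ℕ) :
    IsAscentSequence x ↔ IsAscentSequence (Fin.init x) ∧
      x (Fin.last (n + 1)) ≤ 1 + asc (Fin.init x) := by
  constructor
  · intro h
    exact ⟨fun i => h i.castSucc, (h (Fin.last (n + 1))).2 (Nat.succ_pos n)⟩
  · rintro ⟨h, hl⟩ i
    refine Fin.lastCases ?_ (fun i => h i) i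
    exact ⟨fun h0 => absurd h0 (Nat.succ_ne_zero n), fun _ => hl⟩

/-- An ascent sequence is its initial part together with an admissible last entry. -/
def ascentEquiv (n : ℕ) : {x : Fin (n + 2) → ℕ // IsAscentSequence x} ≃
    Σ x : {x : Fin (n + 1) → ℕ // IsAscentSequence x}, Fin (asc x.1 + 2) where
  toFun x := ⟨⟨Fin.init x.1, ((isAscentSequence_succ _).1 x.2).1⟩,
    ⟨x.1 (Fin.last (n + 1)), by have := ((isAscentSequence_succ _).1 x.2).2; simp only; omega⟩⟩
  invFun y := ⟨Fin.snoc (α := fun _ => ℕ) y.1.1 y.2, by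
    rw [isAscentSequence_succ]
    refine ⟨by simpa using y.1.2, ?_⟩
    have := y.2.2
    simp only [Fin.snoc_last, Fin.init_snoc]; omega⟩
  left_inv x := by simp
  right_inv y := by
    rcases y with ⟨⟨x, hx⟩, j⟩
    simp only [Fin.snoc_last]
    congr 1
    · simp
    · congr 1 <;> simp

theorem isAscentSequence_one_iff (x : Fin 1 → ℕ) : IsAscentSequence x ↔ x = fun _ => 0 := by
  constructor
  · intro h; ext i; exact (h i).1 (by omega)
  · rintro rfl i; exact ⟨fun _ => rfl, fun h => absurd h (by omega)⟩

instance finite_ascentSequence : ∀ n, Finite {x : Fin (n + 1) → ℕ // IsAscentSequence x}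
  | 0 => by
    have : Subsingleton {x : Fin (0 + 1) → ℕ // IsAscentSequence x} :=
      ⟨fun x y => Subtype.ext
        (((isAscentSequence_one_iff _).1 x.2).trans ((isAscentSequence_one_iff _).1 y.2).symm)⟩
    infer_instance
  | n + 1 => by
    have := finite_ascentSequence n
    exact Finite.of_equiv _ (ascentEquiv n).symm

theorem card_ascentSequence (n : ℕ) :
    Nat.card {x : Fin (n + 1) → ℕ // IsAscentSequence x} = treeCount n 0 0 := by
  have : ∀ n, Fintype {x : Fin (n + 1) → ℕ // IsAscentSequence x} := fun n => Fintype.ofFinite _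
  -- The appended entry creates an ascent exactly when it exceeds the previous last entry. The root
  -- is the sequence of length one, which accounts for the shift by X in the series.
  have h := card_eq_sum_treeCount (Y := fun n => {x : Fin (n + 1) → ℕ // IsAscentSequence x})
    (fun n x => asc x.1) (fun n x => x.1 (Fin.last n)) ascentEquiv (fun n x => rfl)
    (fun n x => by
      rw [asc_succ]
      change _ = if x.1 (Fin.last (n + 1)) ≤ x.1 (Fin.last n).castSucc then asc (Fin.init x.1)
        else asc (Fin.init x.1) + 1
      split_ifs <;> omega) n 0
  rw [zero_add] at h
  rw [h]
  have hu : Unique {x : Fin (0 + 1) → ℕ // IsAscentSequence x} :=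
    { default := ⟨fun _ => 0, (isAscentSequence_one_iff _).2 rfl⟩
      uniq := fun x => Subtype.ext ((isAscentSequence_one_iff _).1 x.2) }
  rw [Fintype.sum_unique]
  have h0 : (default : {x : Fin (0 + 1) → ℕ // IsAscentSequence x}).1 = fun _ => 0 :=
    (isAscentSequence_one_iff _).1 (Subtype.prop _)
  simp only [h0]
  rw [asc_eq_sum]
  simp

theorem ascentSeries_eq : ascentSeries = 1 + X * treeSeries 0 0 := by
  ext n
  cases n with
  | zero =>
    have : Unique {x : Fin 0 → ℕ // IsAscentSequence x} :=
      { default := ⟨Fin.elim0, fun i => i.elim0⟩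
        uniq := fun x => Subtype.ext (Subsingleton.elim _ _) }
    simp [ascentSeries]
  | succ n => simp [ascentSeries, treeSeries, coeff_succ_X_mul, coeff_one, card_ascentSequence]

/-! ### Permutations in the generating tree -/

/-- The condition `IsR` expressed by the inverse permutation, which sends a value to its
position. -/
def IsRInv {n : ℕ} (ρ : Equiv.Perm (Fin n)) : Prop :=
  ∀ u v c : Fin n, (v : ℕ) = u + 1 → ρ v < ρ u → (ρ c : ℕ) = ρ v + 1 → c < v

/-- With v = π i, c = π j, u = π k, the pattern says that v = u + 1 stands before u and is followed
immediately by a larger c. -/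
theorem isR_iff_isRInv_symm {n : ℕ} (π : Equiv.Perm (Fin n)) : IsR π ↔ IsRInv π.symm := by
  constructor
  · intro h u v c hvu hlt hc
    by_contra hcv
    have hcv' : v ≠ c := by rintro rfl; omega
    have hvc : v < c := lt_of_le_of_ne (not_lt.1 hcv) hcv'
    have hcu : c ≠ u := by rintro rfl; rw [Fin.lt_def] at hvc; omega
    have hpos : (π.symm c : ℕ) ≠ π.symm u := fun e => hcu (π.symm.injective (Fin.ext e))
    have := h (π.symm v) (π.symm c) (π.symm u) (Fin.lt_def.2 (by omega))
      (Fin.lt_def.2 (by rw [Fin.lt_def] at hlt; omega))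
      (by rw [Fin.lt_def]; simp only [Equiv.apply_symm_apply]; omega)
      (by simpa using hvc)
    simp only [Equiv.apply_symm_apply] at this
    omega
  · intro h i j k hij hjk hki hij'
    by_contra hcon
    push Not at hcon
    have := h (π k) (π i) (π j) hcon.2 (by simpa using hij.trans hjk) (by simpa using hcon.1)
    exact absurd this hij'.not_gt

/-- Insert a new largest value at position `p` into the permutation with position map `ρ`. -/
def insertMax {n : ℕ} (p : Fin (n + 1)) (ρ : Equiv.Perm (Fin n)) : Equiv.Perm (Fin (n + 1)) :=
  ((finSuccEquiv' (Fin.last n)).trans ρ.optionCongr).trans (finSuccEquiv' p).symm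

@[simp] theorem insertMax_last {n : ℕ} (p : Fin (n + 1)) (ρ : Equiv.Perm (Fin n)) :
    insertMax p ρ (Fin.last n) = p := by
  simp [insertMax]

@[simp] theorem insertMax_castSucc {n : ℕ} (p : Fin (n + 1)) (ρ : Equiv.Perm (Fin n))
    (v : Fin n) : insertMax p ρ v.castSucc = p.succAbove (ρ v) := by
  rw [← Fin.succAbove_last_apply]
  simp only [insertMax, Equiv.trans_apply, finSuccEquiv'_succAbove]
  simp

theorem insertMax_bijective (n : ℕ) : Function.Bijective
    (fun x : Equiv.Perm (Fin n) × Fin (n + 1) => insertMax x.2 x.1) := by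
  rw [Fintype.bijective_iff_injective_and_card]
  constructor
  · rintro ⟨ρ, p⟩ ⟨ρ', p'⟩ h
    simp only at h
    have hp : p = p' := by simpa using congrArg (fun f => f (Fin.last n)) h
    subst hp
    have : ρ = ρ' := Equiv.ext fun v => by simpa using congrArg (fun f => f v.castSucc) h
    rw [this]
  · simp [Fintype.card_perm, Nat.factorial_succ, mul_comm]

/-- The sites of a permutation at which inserting a new largest value is allowed. -/
def ActiveSite {n : ℕ} (ρ : Equiv.Perm (Fin n)) (p : Fin (n + 1)) : Prop :=
  ∀ u v : Fin n, (p : ℕ) = ρ v + 1 → (v : ℕ) = u + 1 → ρ u < ρ v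

theorem succAbove_val {n : ℕ} (p : Fin (n + 1)) (i : Fin n) :
    (p.succAbove i : ℕ) = if (i : ℕ) < p then (i : ℕ) else i + 1 := by
  rw [Fin.succAbove]; split_ifs <;> simp_all [Fin.lt_def]

/-- A new maximum can enter a forbidden pattern only as its middle letter, right after some v with v
- 1 further right: an inactive site. An old pattern could be destroyed only by separating its two
adjacent letters, and that site is inactive too. -/
theorem isRInv_insertMax {n : ℕ} (p : Fin (n + 1)) (ρ : Equiv.Perm (Fin n)) :
    IsRInv (insertMax p ρ) ↔ IsRInv ρ ∧ ActiveSite ρ p := by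
  constructor
  · intro h
    have hact : ActiveSite ρ p := by
      intro u v hp huv
      by_contra hlt
      have hne : ρ u ≠ ρ v := fun e => by have := ρ.injective e; subst this; omega
      have hlt' : (ρ v : ℕ) < ρ u := by
        have := lt_of_le_of_ne (not_lt.1 hlt) hne.symm
        exact this
      have := h u.castSucc v.castSucc (Fin.last n) (by simpa using huv)
        (by rw [Fin.lt_def, insertMax_castSucc, insertMax_castSucc, succAbove_val, succAbove_val]
            split_ifs <;> omega)
        (by rw [insertMax_last, insertMax_castSucc, succAbove_val, if_pos (by omega)]; exact hp)
      exact absurd this (not_lt.2 (Fin.le_last _))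
    refine ⟨fun u v c huv hlt hc => ?_, hact⟩
    have hp : (p : ℕ) ≠ ρ v + 1 := fun e => absurd (hact u v e huv) hlt.not_gt
    rw [Fin.lt_def] at hlt
    have := h u.castSucc v.castSucc c.castSucc (by simpa using huv)
        (by rw [Fin.lt_def, insertMax_castSucc, insertMax_castSucc, succAbove_val, succAbove_val]
            split_ifs <;> omega)
        (by rw [insertMax_castSucc, insertMax_castSucc, succAbove_val, succAbove_val]
            split_ifs <;> omega)
    simpa using this
  · rintro ⟨h, hact⟩ u v c
    refine Fin.lastCases ?_ (fun v => ?_) v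
    · intro _ _ hc
      refine lt_of_le_of_ne (Fin.le_last _) ?_
      rintro rfl
      omega
    refine Fin.lastCases ?_ (fun u => ?_) u
    · intro huv; simp at huv; omega
    intro huv
    simp only [Fin.val_castSucc] at huv
    refine Fin.lastCases ?_ (fun c => ?_) c
    · intro hlt hc
      rw [Fin.lt_def, insertMax_castSucc, insertMax_castSucc, succAbove_val, succAbove_val] at hlt
      rw [insertMax_last, insertMax_castSucc, succAbove_val] at hc
      have := hact u v (by split_ifs at hc <;> omega) huv
      rw [Fin.lt_def] at this
      split_ifs at hlt <;> omega
    · intro hlt hc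
      rw [Fin.lt_def, insertMax_castSucc, insertMax_castSucc, succAbove_val, succAbove_val] at hlt
      rw [insertMax_castSucc, insertMax_castSucc, succAbove_val, succAbove_val] at hc
      have hcv : c ≠ v := by rintro rfl; omega
      have hcv' : (ρ c : ℕ) ≠ ρ v := fun e => hcv (ρ.injective (Fin.ext e))
      have := h u v c huv (by rw [Fin.lt_def]; split_ifs at hlt <;> omega)
        (by split_ifs at hc <;> omega)
      simpa using this

open Classical in
/-- The number of active sites to the left of the site `p`. -/
noncomputable def siteLabel {n : ℕ} (ρ : Equiv.Perm (Fin n)) (p : Fin (n + 1)) : ℕ :=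
  #{q | ActiveSite ρ q ∧ q < p}

theorem siteLabel_mono {n : ℕ} (ρ : Equiv.Perm (Fin n)) {p p' : Fin (n + 1)} (h : p ≤ p') :
    siteLabel ρ p ≤ siteLabel ρ p' := by
  classical
  refine card_le_card fun q hq => ?_
  simp only [mem_filter, mem_univ, true_and] at hq ⊢
  exact ⟨hq.1, hq.2.trans_le h⟩

theorem siteLabel_lt {n : ℕ} (ρ : Equiv.Perm (Fin n)) {p p' : Fin (n + 1)} (h : p < p')
    (hp : ActiveSite ρ p) : siteLabel ρ p < siteLabel ρ p' := by
  classical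
  refine card_lt_card ⟨fun q hq => ?_, fun hsub => ?_⟩
  · simp only [mem_filter, mem_univ, true_and] at hq ⊢
    exact ⟨hq.1, hq.2.trans h⟩
  · have : p ∈ ({q | ActiveSite ρ q ∧ q < p} : Finset (Fin (n + 1))) := hsub (by simp [hp, h])
    simp at this

/-- Insertion at p keeps the relative order of the old values and does not move the letters before
p, so it preserves the activity of every site left of p. -/
theorem siteLabel_insertMax {n : ℕ} (ρ : Equiv.Perm (Fin n)) (p : Fin (n + 1)) :
    siteLabel (insertMax p ρ) p.castSucc = siteLabel ρ p := by
  classical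
  have key : ∀ q : Fin (n + 1), q < p → (ActiveSite (insertMax p ρ) q.castSucc ↔
      ActiveSite ρ q) := by
    intro q hqp
    rw [Fin.lt_def] at hqp
    constructor
    · intro h u v hq huv
      have := h u.castSucc v.castSucc
        (by rw [insertMax_castSucc, succAbove_val, if_pos (by omega)]; exact hq) (by simpa using huv)
      rw [Fin.lt_def, insertMax_castSucc, insertMax_castSucc, succAbove_val, succAbove_val] at this
      rw [Fin.lt_def]
      split_ifs at this <;> omega
    · intro h u v
      refine Fin.lastCases ?_ (fun v => ?_) v
      · intro hq; rw [insertMax_last, Fin.val_castSucc] at hq; omega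
      refine Fin.lastCases ?_ (fun u => ?_) u
      · intro _ huv; simp at huv; omega
      intro hq huv
      rw [insertMax_castSucc, succAbove_val, Fin.val_castSucc] at hq
      have := h u v (by split_ifs at hq <;> omega) (by simpa using huv)
      rw [Fin.lt_def] at this
      rw [Fin.lt_def, insertMax_castSucc, insertMax_castSucc, succAbove_val, succAbove_val]
      split_ifs <;> omega
  symm
  refine card_bij (fun q _ => q.castSucc) ?_ ?_ ?_
  · intro q hq
    simp only [mem_filter, mem_univ, true_and] at hq ⊢
    exact ⟨(key q hq.2).2 hq.1, by simpa using hq.2⟩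
  · intro q _ q' _ h
    simpa using h
  · intro q hq
    simp only [mem_filter, mem_univ, true_and] at hq
    have hlt := hq.2
    rw [Fin.lt_def, Fin.val_castSucc] at hlt
    have hcs : (⟨q, by omega⟩ : Fin (n + 1)).castSucc = q := rfl
    refine ⟨⟨q, by omega⟩, ?_, hcs⟩
    simp only [mem_filter, mem_univ, true_and]
    exact ⟨(key _ hlt).1 (by rw [hcs]; exact hq.1), hlt⟩

open Classical in
-- Site 0 and the site after the value 0 are always active; the site after the value j + 1 is active
-- exactly when j is an ascent of ρ.
theorem card_activeSite {n : ℕ} (ρ : Equiv.Perm (Fin (n + 1))) :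
    #{p | ActiveSite ρ p} = asc (fun i => (ρ i : ℕ)) + 2 := by
  have h1 : ∀ v, ActiveSite ρ (ρ v).succ ↔ ∀ u : Fin (n + 1), (v : ℕ) = u + 1 → ρ u < ρ v := by
    intro v
    constructor
    · intro h u huv; exact h u v (by simp) huv
    · intro h u v' hv huv
      have : v' = v := ρ.injective (Fin.ext (by simpa using hv.symm))
      subst this; exact h u huv
  have h0 : ActiveSite ρ 0 := fun u v h => by simp at h
  rw [card_filter, Fin.sum_univ_succ, if_pos h0,
    ← Equiv.sum_comp ρ (fun q => if ActiveSite ρ q.succ then 1 else 0), Fin.sum_univ_succ, asc_eq_sum,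
    if_pos ((h1 0).2 fun u hu => by simp at hu)]
  have h2 : ∀ j : Fin n, ActiveSite ρ (ρ j.succ).succ ↔ (ρ j.castSucc : ℕ) < ρ j.succ := by
    intro j
    rw [h1]
    constructor
    · intro h; exact h _ (by simp)
    · intro h u hu
      have : u = j.castSucc := Fin.ext (by simpa using hu.symm)
      subst this; exact h
  simp only [h2]
  ring

/-- The active sites, numbered from left to right. -/
noncomputable def siteEquiv {n : ℕ} (ρ : Equiv.Perm (Fin (n + 1))) :
    {p // ActiveSite ρ p} ≃ Fin (asc (fun i => (ρ i : ℕ)) + 2) :=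
  Equiv.ofBijective (fun p => ⟨siteLabel ρ p.1, by
    classical
    rw [← card_activeSite]
    refine card_lt_card ⟨fun q hq => ?_, fun hsub => ?_⟩
    · simp only [mem_filter, mem_univ, true_and] at hq ⊢
      exact hq.1
    · have : p.1 ∈ ({q | ActiveSite ρ q ∧ q < p.1} : Finset _) := hsub (by simp [p.2])
      simp at this⟩) <| by
    classical
    rw [Fintype.bijective_iff_injective_and_card]
    constructor
    · intro p p' h
      have h' : siteLabel ρ p.1 = siteLabel ρ p'.1 := congrArg Fin.val h
      rcases lt_trichotomy p.1 p'.1 with hlt | heq | hlt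
      · exact absurd h' (siteLabel_lt ρ hlt p.2).ne
      · exact Subtype.ext heq
      · exact absurd h' (siteLabel_lt ρ hlt p'.2).ne'
    · rw [Fintype.card_fin, ← card_activeSite, Fintype.card_subtype]

/-- Permutations with the `IsRInv` property by removal of the largest value. -/
noncomputable def permEquiv (n : ℕ) : {ρ : Equiv.Perm (Fin (n + 2)) // IsRInv ρ} ≃
    Σ ρ : {ρ : Equiv.Perm (Fin (n + 1)) // IsRInv ρ}, {p // ActiveSite ρ.1 p} :=
  Equiv.symm <| Equiv.ofBijective
    (fun x => ⟨insertMax x.2.1 x.1.1, (isRInv_insertMax _ _).2 ⟨x.1.2, x.2.2⟩⟩) <| by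
    constructor
    · rintro ⟨⟨ρ, hρ⟩, ⟨p, hp⟩⟩ ⟨⟨ρ', hρ'⟩, ⟨p', hp'⟩⟩ h
      have := (insertMax_bijective (n + 1)).1 (a₁ := (ρ, p)) (a₂ := (ρ', p'))
        (congrArg Subtype.val h)
      rw [Prod.mk.injEq] at this
      obtain ⟨rfl, rfl⟩ := this
      rfl
    · rintro ⟨ρ', hρ'⟩
      obtain ⟨⟨ρ, p⟩, rfl⟩ := (insertMax_bijective (n + 1)).2 ρ'
      obtain ⟨h1, h2⟩ := (isRInv_insertMax _ _).1 hρ'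
      exact ⟨⟨⟨ρ, h1⟩, ⟨p, h2⟩⟩, rfl⟩

/-- Otherwise the letter v before the maximum has v - 1 to its right, and v, the maximum and v - 1
form a forbidden pattern. As this site is active, comparing an active site with it amounts to
comparing labels. -/
theorem activeSite_last {n : ℕ} {ρ : Equiv.Perm (Fin (n + 1))} (h : IsRInv ρ) :
    ActiveSite ρ (ρ (Fin.last n)).castSucc := by
  intro u v hp huv
  by_contra hlt
  have hne : ρ u ≠ ρ v := fun e => by have := ρ.injective e; subst this; omega
  exact absurd (h u v (Fin.last n) huv (lt_of_le_of_ne (not_lt.1 hlt) hne.symm)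
    (by simpa using hp)) (not_lt.2 (Fin.le_last _))

theorem asc_insertMax {n : ℕ} (p : Fin (n + 2)) (ρ : Equiv.Perm (Fin (n + 1))) :
    asc (fun i => (insertMax p ρ i : ℕ)) = asc (fun i => (ρ i : ℕ)) +
      if (ρ (Fin.last n)).castSucc < p then 1 else 0 := by
  rw [asc_succ, asc_eq_sum, asc_eq_sum]
  congr 1
  · refine sum_congr rfl fun j _ => ?_
    simp only [Fin.init, insertMax_castSucc, succAbove_val]
    congr 1
    apply propext
    split_ifs <;> omega
  · rw [insertMax_castSucc, insertMax_last, succAbove_val]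
    simp only [Fin.lt_def, Fin.val_castSucc]
    split_ifs <;> omega

theorem card_isRInv (n : ℕ) :
    Nat.card {ρ : Equiv.Perm (Fin (n + 1)) // IsRInv ρ} = treeCount n 0 0 := by
  classical
  have h := card_eq_sum_treeCount (Y := fun n => {ρ : Equiv.Perm (Fin (n + 1)) // IsRInv ρ})
    (fun n ρ => asc (fun i => (ρ.1 i : ℕ)))
    (fun n ρ => siteLabel ρ.1 (ρ.1 (Fin.last n)).castSucc)
    (fun n => (permEquiv n).trans (Equiv.sigmaCongrRight fun ρ => siteEquiv ρ.1))
    (fun n ρ => by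
      obtain ⟨⟨ρ, p⟩, rfl⟩ := (permEquiv n).symm.surjective ρ
      change siteLabel (insertMax p.1 ρ.1) (insertMax p.1 ρ.1 (Fin.last _)).castSucc =
        (siteEquiv ((permEquiv n) ((permEquiv n).symm ⟨ρ, p⟩)).1.1
          ((permEquiv n) ((permEquiv n).symm ⟨ρ, p⟩)).2 : ℕ)
      rw [Equiv.apply_symm_apply, insertMax_last, siteLabel_insertMax]
      rfl)
    (fun n ρ => by
      obtain ⟨⟨ρ, p⟩, rfl⟩ := (permEquiv n).symm.surjective ρ
      change asc (fun i => (insertMax p.1 ρ.1 i : ℕ)) =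
        if (siteEquiv ((permEquiv n) ((permEquiv n).symm ⟨ρ, p⟩)).1.1
          ((permEquiv n) ((permEquiv n).symm ⟨ρ, p⟩)).2 : ℕ) ≤
          siteLabel ((permEquiv n) ((permEquiv n).symm ⟨ρ, p⟩)).1.1
            (((permEquiv n) ((permEquiv n).symm ⟨ρ, p⟩)).1.1 (Fin.last n)).castSucc
        then asc (fun i => (((permEquiv n) ((permEquiv n).symm ⟨ρ, p⟩)).1.1 i : ℕ))
        else asc (fun i => (((permEquiv n) ((permEquiv n).symm ⟨ρ, p⟩)).1.1 i : ℕ)) + 1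
      rw [Equiv.apply_symm_apply]
      change _ = if siteLabel ρ.1 p.1 ≤ siteLabel ρ.1 (ρ.1 (Fin.last n)).castSucc then _ else _
      -- A new ascent of the inverse arises exactly when the new maximum lands to the right of the
      -- old one.
      rw [asc_insertMax]
      have hact := activeSite_last ρ.2
      by_cases hlt : (ρ.1 (Fin.last n)).castSucc < p.1
      · rw [if_pos hlt, if_neg (not_le.2 (siteLabel_lt _ hlt hact))]
      · rw [if_neg hlt, if_pos (siteLabel_mono _ (not_lt.1 hlt))]
        rfl) n 0
  rw [zero_add] at h
  rw [h]
  have hu : Unique {ρ : Equiv.Perm (Fin (0 + 1)) // IsRInv ρ} :=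
    { default := ⟨1, fun u v c h => by omega⟩
      uniq := fun x => Subtype.ext (Equiv.ext fun i => Subsingleton.elim (α := Fin 1) _ _) }
  rw [Fintype.sum_unique, asc_eq_sum]
  congr 1
  rw [siteLabel, card_eq_zero, filter_eq_empty_iff]
  intro q _ hq
  have := hq.2
  rw [Fin.lt_def, Fin.val_castSucc] at this
  omega

theorem permSeries_eq : permSeries = 1 + X * treeSeries 0 0 := by
  ext n
  have h : Nat.card {π : Equiv.Perm (Fin n) // IsR π} =
      Nat.card {ρ : Equiv.Perm (Fin n) // IsRInv ρ} :=
    Nat.card_congr ((Equiv.inv (Equiv.Perm (Fin n))).subtypeEquiv fun π => isR_iff_isRInv_symm π)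
  cases n with
  | zero =>
    have : Unique {ρ : Equiv.Perm (Fin 0) // IsRInv ρ} :=
      { default := ⟨1, fun i => i.elim0⟩
        uniq := fun x => Subtype.ext (Subsingleton.elim _ _) }
    simp [permSeries, h]
  | succ n => simp [permSeries, treeSeries, coeff_succ_X_mul, coeff_one, h, card_isRInv]

/-! ### The inclusion-exclusion recursion and its `q`-series -/

/-- The polynomials in `Q` obtained by inclusion-exclusion on empty rows. -/
def signedSum {R : Type*} [CommRing R] (Q : R) : ℕ → ℕ → R
  | 0, _ => 1
  | m + 1, d => (Q ^ (d + 1) - 1) * signedSum Q m (d + 1) - (Q ^ d - 1) * signedSum Q m d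

/-- Allows `qInv` to be replaced by a truncated geometric series modulo a power of X. -/
theorem sub_dvd_signedSum_sub {R : Type*} [CommRing R] (P Q : R) (m : ℕ) :
    ∀ d, P - Q ∣ signedSum P m d - signedSum Q m d := by
  induction m with
  | zero => simp [signedSum]
  | succ m ih =>
    intro d
    have h : ∀ k, P - Q ∣ (P ^ k - 1) * signedSum P m k - (Q ^ k - 1) * signedSum Q m k := by
      intro k
      have e : (P ^ k - 1) * signedSum P m k - (Q ^ k - 1) * signedSum Q m k =
          (P ^ k - Q ^ k) * signedSum P m k +
          (Q ^ k - 1) * (signedSum P m k - signedSum Q m k) := by ring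
      rw [e]
      exact dvd_add ((sub_dvd_pow_sub_pow P Q k).mul_right _) ((ih k).mul_left _)
    have e : signedSum P (m + 1) d - signedSum Q (m + 1) d =
        ((P ^ (d + 1) - 1) * signedSum P m (d + 1) - (Q ^ (d + 1) - 1) * signedSum Q m (d + 1)) -
        ((P ^ d - 1) * signedSum P m d - (Q ^ d - 1) * signedSum Q m d) := by
      simp only [signedSum]; ring
    rw [e]
    exact dvd_sub (h _) (h _)

/-- The function b marks the rows allowed to be nonzero, and d counts the rows admitted beforehand.
The recursion splits on whether the first remaining row is admitted or forced to vanish, the latter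
with sign -1. -/
theorem signedSum_eq_sum {R : Type*} [CommRing R] (Q : R) (m : ℕ) : ∀ d, signedSum Q m d =
    ∑ b : Fin m → Bool, (∏ i, if b i then 1 else -1) *
      ∏ j : Fin m, (Q ^ (d + ∑ i : Fin m, if i ≤ j ∧ b i then 1 else 0) - 1) := by
  induction m with
  | zero => simp [signedSum]
  | succ m ih =>
    intro d
    rw [← (Fin.consEquiv fun _ => Bool).sum_comp, Fintype.sum_prod_type]
    simp only [Fin.consEquiv, Equiv.coe_fn_mk, Fin.prod_univ_succ, Fin.sum_univ_succ,
      Fin.cons_zero, Fin.cons_succ, Fintype.sum_bool]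
    have hz : ∀ i : Fin m, ¬ i.succ ≤ 0 := fun i => not_le.2 (Fin.succ_pos i)
    simp only [Fin.succ_le_succ_iff, Fin.zero_le, true_and, if_true, Bool.false_eq_true, if_false,
      zero_add, le_refl, hz, false_and, sum_const_zero, add_zero, signedSum, ih,
      mul_sum, sub_eq_add_neg, ← sum_neg_distrib]
    congr 1
    · refine sum_congr rfl fun b _ => ?_
      simp only [← add_assoc]; ring
    · refine sum_congr rfl fun b _ => ?_
      ring

theorem X_pow_dvd_signedSum (m : ℕ) : ∀ d, (X : ℤ⟦X⟧) ^ m ∣ signedSum qInv m d := by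
  induction m with
  | zero => simp
  | succ m ih =>
    intro d
    have h : ∀ k, (X : ℤ⟦X⟧) ∣ qInv ^ k - 1 := by
      intro k; rw [X_dvd_iff]; simp [qInv]
    rw [pow_succ', signedSum]
    exact dvd_sub (mul_dvd_mul (h _) (ih _)) (mul_dvd_mul (h _) (ih _))

/-- Sum the defining recursion over m and use Q^{d+1} - 1 = (1 - q^{d+1}) Q^{d+1} for Q = 1/q. -/
theorem sum_signedSum_rec (N d : ℕ) :
    qInv ^ d * ∑ m ∈ range N, signedSum qInv m d =
      1 + (1 - qBase ^ (d + 1)) * (qInv ^ (d + 1) * ∑ m ∈ range N, signedSum qInv m (d + 1)) -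
        signedSum qInv N d := by
  have h1 : ∑ m ∈ range N, signedSum qInv (m + 1) d =
      (qInv ^ (d + 1) - 1) * (∑ m ∈ range N, signedSum qInv m (d + 1)) -
      (qInv ^ d - 1) * ∑ m ∈ range N, signedSum qInv m d := by
    simp only [signedSum, sum_sub_distrib, mul_sum]
  have h2 := sum_range_succ (fun m => signedSum qInv m d) N
  rw [sum_range_succ', h1] at h2
  have h0 : signedSum qInv 0 d = 1 := rfl
  have hp : qInv ^ (d + 1) * qBase ^ (d + 1) = 1 := by
    rw [← mul_pow, qInv_mul_qBase, one_pow]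
  rw [h0] at h2
  linear_combination -h2 + (∑ m ∈ range N, signedSum qInv m (d + 1)) * hp

theorem X_pow_dvd_sum_signedSum_sub (N : ℕ) :
    (X : ℤ⟦X⟧) ^ N ∣ ∑ m ∈ range N, signedSum qInv m 0 - ∑ k ∈ range N, qPoch k := by
  -- Iterating the recursion r times from d = 0 accumulates the factors 1 - q^{d+1} into (q)_r; at r
  -- = N the remainder is divisible by t^N.
  have h : ∀ r, ∑ m ∈ range N, signedSum qInv m 0 = ∑ k ∈ range r, qPoch k +
      qPoch r * (qInv ^ r * ∑ m ∈ range N, signedSum qInv m r) -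
      ∑ k ∈ range r, qPoch k * signedSum qInv N k := by
    intro r
    induction r with
    | zero => simp [qPoch_zero]
    | succ r ih =>
      rw [ih, sum_signedSum_rec N r, sum_range_succ, sum_range_succ, qPoch_succ]
      ring
  rw [h N]
  have e : ∀ a b c : ℤ⟦X⟧, a + b - c - a = b - c := fun a b c => by ring
  rw [e]
  exact dvd_sub ((X_pow_dvd_qPoch N).mul_right _)
    (dvd_sum fun k _ => (X_pow_dvd_signedSum N k).mul_left _)

/-! ### Counting matrices without zero rows or columns -/

/-- An upper triangular matrix without zero rows or columns, of total weight `n`; the first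
argument of `M` is the column. -/
def IsFishMatrix {m : ℕ} (n : ℕ) (M : Fin m → Fin m → ℕ) : Prop :=
  (∀ j i, j < i → M j i = 0) ∧ (∀ j, ∃ i, M j i ≠ 0) ∧ (∀ i, ∃ j, M j i ≠ 0) ∧
    ∑ j, ∑ i, M j i = n

theorem ite_exists_ne_zero {ι R : Type*} [Fintype ι] [CommRing R] (v : ι → ℕ)
    [Decidable (∃ j, v j ≠ 0)] :
    (if ∃ j, v j ≠ 0 then (1 : R) else 0) =
      ∑ b : Bool, (if b then 1 else -1) * ∏ j, if b ∨ v j = 0 then (1 : R) else 0 := by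
  classical
  simp only [Fintype.sum_bool, true_or, if_true, prod_const_one, Bool.false_eq_true, false_or,
    if_false]
  by_cases h : ∃ j, v j ≠ 0
  · obtain ⟨j, hj⟩ := h
    rw [if_pos ⟨j, hj⟩, prod_eq_zero (mem_univ j) (if_neg hj)]
    ring
  · rw [if_neg h]
    push Not at h
    simp [h]

/-- Each admitted row i ≤ j contributes one free entry, all other entries vanish, and the zero
column is removed. Entries are capped at n to keep the sum finite. -/
theorem sum_column {m : ℕ} (n : ℕ) (j : Fin m) (b : Fin m → Bool) :
    ∑ v ∈ Fintype.piFinset (fun i : Fin m => if i ≤ j then range (n + 1) else {0}),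
      (((X : ℤ⟦X⟧) ^ ∑ i, v i) * (if ∃ i, v i ≠ 0 then 1 else 0) *
        ∏ i, if b i ∨ v i = 0 then 1 else 0) =
      (∑ k ∈ range (n + 1), (X : ℤ⟦X⟧) ^ k) ^ (∑ i : Fin m, if i ≤ j ∧ b i then 1 else 0) - 1 := by
  have h1 : ∀ v : Fin m → ℕ, (((X : ℤ⟦X⟧) ^ ∑ i, v i) * (if ∃ i, v i ≠ 0 then 1 else 0) *
        ∏ i, if b i ∨ v i = 0 then 1 else 0) =
      ∏ i, (X ^ v i * if b i ∨ v i = 0 then 1 else 0) - if v = 0 then 1 else 0 := by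
    intro v
    rw [prod_mul_distrib, prod_pow_eq_pow_sum]
    by_cases hv : v = 0
    · subst hv; simp
    · have : ∃ i, v i ≠ 0 := by
        by_contra hcon; push Not at hcon; exact hv (funext hcon)
      rw [if_pos this, if_neg hv]; ring
  rw [sum_congr rfl fun v _ => h1 v, sum_sub_distrib]
  congr 1
  · rw [← prod_univ_sum (fun i : Fin m => if i ≤ j then range (n + 1) else {0})
      (fun i k => (X : ℤ⟦X⟧) ^ k * if b i ∨ k = 0 then 1 else 0), ← prod_pow_eq_pow_sum]
    refine prod_congr rfl fun i _ => ?_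
    by_cases hi : i ≤ j
    · by_cases hb : b i
      · simp [hi, hb]
      · simp [hi, hb]
    · simp [hi]
  · rw [sum_ite_eq', if_pos]
    simp only [Fintype.mem_piFinset, Pi.zero_apply]
    intro i
    split_ifs <;> simp

/-- Expanding the condition on each row as 1 minus the indicator of a zero row makes the columns
independent. -/
theorem sum_matrix (m n : ℕ) :
    ∑ M ∈ Fintype.piFinset (fun j : Fin m => Fintype.piFinset
        (fun i : Fin m => if i ≤ j then range (n + 1) else {0})),
      ((X : ℤ⟦X⟧) ^ ∑ j, ∑ i, M j i) * (∏ j, if ∃ i, M j i ≠ 0 then 1 else 0) *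
        (∏ i, if ∃ j, M j i ≠ 0 then 1 else 0) =
      signedSum (∑ k ∈ range (n + 1), (X : ℤ⟦X⟧) ^ k) m 0 := by
  rw [signedSum_eq_sum]
  have h1 : ∀ M : Fin m → Fin m → ℕ, (∏ i, if ∃ j, M j i ≠ 0 then (1 : ℤ⟦X⟧) else 0) =
      ∑ b : Fin m → Bool, (∏ i, if b i then 1 else -1) *
        ∏ j, ∏ i, if b i ∨ M j i = 0 then (1 : ℤ⟦X⟧) else 0 := by
    intro M
    rw [prod_congr rfl fun i _ => ite_exists_ne_zero (fun j => M j i), prod_univ_sum,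
      Fintype.piFinset_univ]
    refine sum_congr rfl fun b _ => ?_
    rw [prod_mul_distrib, prod_comm (s := univ) (t := univ)]
  refine (sum_congr rfl fun M _ => (congrArg _ (h1 M)).trans (mul_sum _ _ _)).trans ?_
  rw [sum_comm]
  refine sum_congr rfl fun b _ => ?_
  simp only [zero_add, ← sum_column]
  rw [prod_univ_sum, mul_sum]
  refine sum_congr rfl fun M _ => ?_
  rw [prod_mul_distrib, prod_mul_distrib, prod_pow_eq_pow_sum]
  ring

theorem card_isFishMatrix (m n : ℕ) :
    (Nat.card {M : Fin m → Fin m → ℕ // IsFishMatrix n M} : ℤ) =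
      coeff n (signedSum qInv m 0) := by
  classical
  -- No entry of a matrix of weight n exceeds n, so truncating the geometric series after degree n
  -- does not affect the coefficient in question.
  have hd : (X : ℤ⟦X⟧) ^ (n + 1) ∣ (∑ k ∈ range (n + 1), X ^ k) - qInv := by
    rw [X_pow_dvd_iff]
    intro k hk
    rw [map_sub, map_sum]
    simp [qInv, coeff_X_pow, hk]
  have hc := (X_pow_dvd_iff.1 (hd.trans (sub_dvd_signedSum_sub _ _ m 0))) n (by omega)
  rw [map_sub, sub_eq_zero] at hc
  rw [← hc, ← sum_matrix, map_sum]
  rw [Nat.subtype_card ({M ∈ Fintype.piFinset (fun j : Fin m => Fintype.piFinset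
        (fun i : Fin m => if i ≤ j then range (n + 1) else {0})) | IsFishMatrix n M})]
  · rw [card_filter, Nat.cast_sum]
    refine sum_congr rfl fun M hM => ?_
    have hup : ∀ j i, j < i → M j i = 0 := by
      intro j i hji
      have := Fintype.mem_piFinset.1 (Fintype.mem_piFinset.1 hM j) i
      rw [if_neg (not_le.2 hji)] at this
      simpa using this
    rw [Finset.prod_ite_zero, Finset.prod_ite_zero]
    simp only [mem_univ, forall_true_left, prod_const_one]
    by_cases h1 : ∀ j, ∃ i, M j i ≠ 0
    · by_cases h2 : ∀ i, ∃ j, M j i ≠ 0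
      · rw [if_pos h1, if_pos h2, mul_one, mul_one, coeff_X_pow]
        have : IsFishMatrix n M ↔ n = ∑ j, ∑ i, M j i :=
          ⟨fun h => h.2.2.2.symm, fun h => ⟨hup, h1, h2, h.symm⟩⟩
        simp [this]
      · rw [if_neg h2]; simp [IsFishMatrix, h2]
    · rw [if_neg h1]; simp [IsFishMatrix, h1]
  · intro M
    rw [mem_filter]
    refine ⟨fun h => h.2, fun h => ⟨?_, h⟩⟩
    rw [Fintype.mem_piFinset]
    intro j
    rw [Fintype.mem_piFinset]
    intro i
    split_ifs with hij
    · rw [mem_range, Nat.lt_succ_iff, ← h.2.2.2]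
      exact (single_le_sum (f := fun i => M j i) (fun _ _ => Nat.zero_le _) (mem_univ i)).trans
        (single_le_sum (f := fun j => ∑ i, M j i) (fun _ _ => Nat.zero_le _) (mem_univ j))
    · simpa using h.1 j i (not_le.1 hij)

/-! ### Interval multisets as matrices -/

/-- A multiset of intervals `[i, j]` with `0 ≤ i ≤ j < m` such that each `k < m` is a left endpoint
and a right endpoint. -/
def IsIntervalMultiset (m : ℕ) (s : Multiset (ℕ × ℕ)) : Prop :=
  (∀ p ∈ s, p.1 ≤ p.2) ∧ (∀ i, (∃ p ∈ s, p.1 = i) ↔ i < m) ∧ (∀ i, (∃ p ∈ s, p.2 = i) ↔ i < m)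

theorem IsIntervalMultiset.unique {m m' : ℕ} {s : Multiset (ℕ × ℕ)}
    (h : IsIntervalMultiset m s) (h' : IsIntervalMultiset m' s) : m = m' := by
  have : ∀ i, i < m ↔ i < m' := fun i => (h.2.1 i).symm.trans (h'.2.1 i)
  have h1 := this m
  have h2 := this m'
  omega

theorem IsIntervalMultiset.le_card {m : ℕ} {s : Multiset (ℕ × ℕ)}
    (h : IsIntervalMultiset m s) : m ≤ s.card := by
  have : range m ⊆ (s.map Prod.fst).toFinset := by
    intro i hi
    simpa using (h.2.1 i).2 (mem_range.1 hi)
  calc m = #(range m) := (card_range m).symm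
    _ ≤ #(s.map Prod.fst).toFinset := card_le_card this
    _ ≤ (s.map Prod.fst).card := Multiset.toFinset_card_le _
    _ = s.card := Multiset.card_map _ _

/-- The interval multisets with `n` elements. -/
def IntervalMultiset (n : ℕ) : Type :=
  {s : Multiset (ℕ × ℕ) // s.card = n ∧ ∃ m, IsIntervalMultiset m s}

/-- Interval multisets by the number of endpoints. -/
noncomputable def intervalMultisetEquiv (n : ℕ) : IntervalMultiset n ≃
    Σ m : Fin (n + 1), {s : Multiset (ℕ × ℕ) // s.card = n ∧ IsIntervalMultiset m s} :=
  Equiv.symm <| Equiv.ofBijective (fun x => ⟨x.2.1, x.2.2.1, x.1, x.2.2.2⟩) <| by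
    constructor
    · rintro ⟨⟨m, hm⟩, ⟨s, hs⟩⟩ ⟨⟨m', hm'⟩, ⟨s', hs'⟩⟩ h
      have e : s = s' := congrArg Subtype.val h
      subst e
      have e := IsIntervalMultiset.unique hs.2 hs'.2
      simp only at e
      subst e
      rfl
    · rintro ⟨s, hn, m, hm⟩
      have := hm.le_card
      exact ⟨⟨⟨m, by omega⟩, ⟨s, hn, hm⟩⟩, rfl⟩

theorem sum_count_eq_card {m : ℕ} {s : Multiset (ℕ × ℕ)}
    (h : ∀ p ∈ s, p.1 < m ∧ p.2 < m) :
    ∑ j : Fin m, ∑ i : Fin m, s.count ((i : ℕ), (j : ℕ)) = s.card := by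
  rw [← Multiset.sum_count_eq_card (s := range m ×ˢ range m) (fun p hp => by simpa using h p hp),
    sum_product_right, Finset.sum_range]
  refine sum_congr rfl fun j _ => ?_
  rw [Finset.sum_range]

theorem IsIntervalMultiset.lt {m : ℕ} {s : Multiset (ℕ × ℕ)} (h : IsIntervalMultiset m s) :
    ∀ p ∈ s, p.1 < m ∧ p.2 < m :=
  fun p hp => ⟨(h.2.1 _).1 ⟨p, hp, rfl⟩, (h.2.2 _).1 ⟨p, hp, rfl⟩⟩

/-- An interval multiset as the matrix of its multiplicities. -/
noncomputable def intervalMatrixEquiv (m n : ℕ) :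
    {s : Multiset (ℕ × ℕ) // s.card = n ∧ IsIntervalMultiset m s} ≃
      {M : Fin m → Fin m → ℕ // IsFishMatrix n M} := by
  refine Equiv.ofBijective
    (fun s => ⟨fun j i => s.1.count ((i : ℕ), (j : ℕ)), ?_, ?_, ?_, ?_⟩) ⟨?_, ?_⟩
  · intro j i hji
    rw [Multiset.count_eq_zero]
    intro hmem
    exact absurd (s.2.2.1 _ hmem) (not_le.2 hji)
  · intro j
    obtain ⟨⟨a, b⟩, hp, hpj⟩ := (s.2.2.2.2 j).2 j.2
    simp only at hpj
    subst hpj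
    exact ⟨⟨a, (s.2.2.lt _ hp).1⟩, (Multiset.count_pos.2 hp).ne'⟩
  · intro i
    obtain ⟨⟨a, b⟩, hp, hpj⟩ := (s.2.2.2.1 i).2 i.2
    simp only at hpj
    subst hpj
    exact ⟨⟨b, (s.2.2.lt _ hp).2⟩, (Multiset.count_pos.2 hp).ne'⟩
  · rw [sum_count_eq_card s.2.2.lt, s.2.1]
  · rintro ⟨s, hs⟩ ⟨s', hs'⟩ h
    refine Subtype.ext (Multiset.ext.2 fun p => ?_)
    have h' := congrArg Subtype.val h
    by_cases hp : p.1 < m ∧ p.2 < m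
    · exact congrFun (congrFun h' ⟨p.2, hp.2⟩) ⟨p.1, hp.1⟩
    · rw [Multiset.count_eq_zero.2 fun hm => hp (hs.2.lt p hm),
        Multiset.count_eq_zero.2 fun hm => hp (hs'.2.lt p hm)]
  · rintro ⟨M, hM⟩
    obtain ⟨hup, hcol, hrow, hsum⟩ := hM
    set s : Multiset (ℕ × ℕ) := ∑ j : Fin m, ∑ i : Fin m, M j i • {((i : ℕ), (j : ℕ))} with hs
    have hcount : ∀ j i : Fin m, s.count ((i : ℕ), (j : ℕ)) = M j i := by
      intro j i
      rw [hs, Multiset.count_sum', sum_eq_single j]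
      · rw [Multiset.count_sum', sum_eq_single i]
        · simp
        · intro i' _ hi'
          rw [Multiset.count_nsmul, Multiset.count_singleton, if_neg, mul_zero]
          intro e
          exact hi' (Fin.ext (congrArg Prod.fst e).symm)
        · simp
      · intro j' _ hj'
        rw [Multiset.count_sum']
        refine sum_eq_zero fun i' _ => ?_
        rw [Multiset.count_nsmul, Multiset.count_singleton, if_neg, mul_zero]
        intro e
        exact hj' (Fin.ext (congrArg Prod.snd e).symm)
      · simp
    have hmem : ∀ p ∈ s, ∃ j i : Fin m, p = ((i : ℕ), (j : ℕ)) ∧ M j i ≠ 0 := by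
      intro p hp
      rw [hs, Multiset.mem_sum] at hp
      obtain ⟨j, _, hp⟩ := hp
      rw [Multiset.mem_sum] at hp
      obtain ⟨i, _, hp⟩ := hp
      rw [Multiset.mem_nsmul, Multiset.mem_singleton] at hp
      exact ⟨j, i, hp.2, hp.1⟩
    have hmem' : ∀ j i : Fin m, M j i ≠ 0 → ((i : ℕ), (j : ℕ)) ∈ s := by
      intro j i h
      rw [← Multiset.count_pos, hcount]
      omega
    have hcard : s.card = n := by
      rw [← hsum, ← sum_count_eq_card (m := m) (s := s)]
      · simp only [hcount]
      · intro p hp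
        obtain ⟨j, i, rfl, _⟩ := hmem p hp
        exact ⟨i.2, j.2⟩
    refine ⟨⟨s, hcard, ?_, ?_, ?_⟩, Subtype.ext (funext fun j => funext fun i => hcount j i)⟩
    · intro p hp
      obtain ⟨j, i, rfl, h⟩ := hmem p hp
      by_contra hcon
      exact h (hup j i (not_le.1 hcon))
    · intro i
      constructor
      · rintro ⟨p, hp, rfl⟩
        obtain ⟨j, i, rfl, h⟩ := hmem p hp
        exact i.2
      · intro hi
        obtain ⟨j, hj⟩ := hrow ⟨i, hi⟩
        exact ⟨_, hmem' _ _ hj, rfl⟩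
    · intro j
      constructor
      · rintro ⟨p, hp, rfl⟩
        obtain ⟨j, i, rfl, h⟩ := hmem p hp
        exact j.2
      · intro hj
        obtain ⟨i, hi⟩ := hcol ⟨j, hj⟩
        exact ⟨_, hmem' _ _ hi, rfl⟩

theorem finite_isFishMatrix (m n : ℕ) : Finite {M : Fin m → Fin m → ℕ // IsFishMatrix n M} := by
  refine Finite.of_injective (β := Fin m → Fin m → Fin (n + 1))
    (fun M j i => ⟨M.1 j i, ?_⟩) ?_
  · rw [Nat.lt_succ_iff]
    exact ((single_le_sum (f := fun i => M.1 j i) (fun _ _ => Nat.zero_le _) (mem_univ i)).trans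
      (single_le_sum (f := fun j => ∑ i, M.1 j i) (fun _ _ => Nat.zero_le _)
        (mem_univ j))).trans_eq M.2.2.2.2
  · intro M M' h
    refine Subtype.ext (funext fun j => funext fun i => ?_)
    exact congrArg Fin.val (congrFun (congrFun h j) i)

/-- The generating function of interval multisets. -/
noncomputable def intervalSeries : ℤ⟦X⟧ :=
  PowerSeries.mk fun n => (Nat.card (IntervalMultiset n) : ℤ)

theorem coeff_intervalSeries (n : ℕ) :
    coeff n intervalSeries = ∑ m ∈ range (n + 1), coeff n (signedSum qInv m 0) := by
  rw [intervalSeries, coeff_mk, Nat.card_congr (intervalMultisetEquiv n)]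
  have hf : ∀ m : ℕ, Finite {s : Multiset (ℕ × ℕ) // s.card = n ∧ IsIntervalMultiset m s} := by
    intro m
    have := finite_isFishMatrix m n
    exact Finite.of_equiv _ (intervalMatrixEquiv m n).symm
  rw [Nat.card_sigma, Nat.cast_sum, ← Fin.sum_univ_eq_sum_range
    (fun m => coeff n (signedSum qInv m 0))]
  refine sum_congr rfl fun m _ => ?_
  rw [Nat.card_congr (intervalMatrixEquiv m n), card_isFishMatrix]

theorem X_pow_dvd_intervalSeries_sub (N : ℕ) :
    (X : ℤ⟦X⟧) ^ N ∣ intervalSeries - ∑ k ∈ range N, qPoch k := by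
  have h := X_pow_dvd_sum_signedSum_sub N
  rw [X_pow_dvd_iff] at h ⊢
  intro n hn
  have h1 := h n hn
  rw [map_sub] at h1 ⊢
  rw [coeff_intervalSeries]
  convert h1 using 2
  rw [map_sum]
  -- The terms with m > n contribute nothing, since X^m divides them.
  refine sum_subset (range_subset_range.2 (by omega)) fun m _ hm => ?_
  exact X_pow_dvd_iff.1 (X_pow_dvd_signedSum m 0) n (by simpa using hm)

/-! ### Canonical interval representations of (2+2)-free posets -/

/-- Two families with the same multiset of values agree up to a permutation of the indices. -/
theorem exists_perm_of_map_eq {n : ℕ} {β : Type*} (f g : Fin n → β)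
    (h : univ.val.map f = univ.val.map g) : ∃ e : Equiv.Perm (Fin n), ∀ i, f i = g (e i) := by
  classical
  have hc : ∀ b, Nonempty ({i // f i = b} ≃ {i // g i = b}) := by
    intro b
    have hb := congrArg (Multiset.count b) h
    rw [Multiset.count_map, Multiset.count_map] at hb
    rw [← Fintype.card_eq, Fintype.card_subtype, Fintype.card_subtype]
    simp only [Finset.card_def, Finset.filter_val]
    simpa only [eq_comm] using hb
  let c := fun b => (hc b).some
  refine ⟨(Equiv.sigmaFiberEquiv f).symm.trans ((Equiv.sigmaCongrRight c).trans
    (Equiv.sigmaFiberEquiv g)), fun i => ?_⟩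
  exact (c (f i) ⟨i, rfl⟩).2.symm

theorem exists_family_of_card {n : ℕ} {β : Type*} (s : Multiset β) (hs : s.card = n) :
    ∃ f : Fin n → β, univ.val.map f = s := by
  obtain ⟨L, rfl⟩ : ∃ L : List β, s = L := ⟨s.toList, s.coe_toList.symm⟩
  rw [Multiset.coe_card] at hs
  subst hs
  exact ⟨L.get, by rw [Fin.univ_val_map, List.ofFn_get]⟩

/-- An interval representation of a poset in which all `k < m` occur both as left and as right
endpoints. -/
def IsRep {α : Type*} (lt : α → α → Prop) (l r : α → ℕ) (m : ℕ) : Prop :=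
  (∀ x, l x ≤ r x) ∧ (∀ x y, lt x y ↔ r x < l y) ∧ (∀ i, (∃ x, l x = i) ↔ i < m) ∧
    (∀ i, (∃ x, r x = i) ↔ i < m)

/-- Since f skips no value, an x of value k + 1 has some y of value k below it, and g must rise
strictly from y to x. -/
theorem le_of_lt_imp_lt {α : Type*} {f g : α → ℕ} {m : ℕ} (hf : ∀ i, (∃ x, f x = i) ↔ i < m)
    (h : ∀ x y, f x < f y → g x < g y) : ∀ k x, f x = k → k ≤ g x := by
  intro k
  induction k with
  | zero => simp
  | succ k ih =>
    intro x hx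
    have hm : k + 1 < m := (hf _).1 ⟨x, hx⟩
    obtain ⟨y, hy⟩ := (hf k).2 (by omega)
    have := ih y hy
    have := h y x (by omega)
    omega

/-- Expresses the order of the left ends through the poset alone. The witness z has right end l x,
which is available because every left end also occurs as a right end. -/
theorem IsRep.lt_iff {α : Type*} {lt : α → α → Prop} {l r : α → ℕ} {m : ℕ}
    (h : IsRep lt l r m) (x y : α) : l x < l y ↔ ∃ z, lt z y ∧ ¬ lt z x := by
  obtain ⟨-, hlt, hl, hr⟩ := h
  constructor
  · intro hxy
    obtain ⟨z, hz⟩ := (hr (l x)).2 ((hl _).1 ⟨x, rfl⟩)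
    exact ⟨z, by rw [hlt]; omega, by rw [hlt]; omega⟩
  · rintro ⟨z, h1, h2⟩
    rw [hlt] at h1 h2
    omega

/-- The left ends are comparable in the same way and skip no value, so they agree. A right end is
then determined by the left ends exceeding it, since all values occur as left ends. -/
theorem IsRep.unique {α : Type*} {lt : α → α → Prop} {l r l' r' : α → ℕ} {m m' : ℕ}
    (h : IsRep lt l r m) (h' : IsRep lt l' r' m') : l = l' ∧ r = r' := by
  have e : l = l' := funext fun x => le_antisymm
    (le_of_lt_imp_lt h.2.2.1 (fun x y hxy => (h'.lt_iff x y).2 ((h.lt_iff x y).1 hxy)) _ x rfl)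
    (le_of_lt_imp_lt h'.2.2.1 (fun x y hxy => (h.lt_iff x y).2 ((h'.lt_iff x y).1 hxy)) _ x rfl)
  subst e
  refine ⟨rfl, funext fun x => ?_⟩
  have key : ∀ y, r x < l y ↔ r' x < l y := fun y => (h.2.1 x y).symm.trans (h'.2.1 x y)
  obtain ⟨y, hy⟩ := (h.2.2.1 (r x)).2 ((h.2.2.2 _).1 ⟨x, rfl⟩)
  obtain ⟨y', hy'⟩ := (h'.2.2.1 (r' x)).2 ((h'.2.2.2 _).1 ⟨x, rfl⟩)
  have h1 := key y
  have h2 := key y'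
  omega

section Existence

variable {α : Type*} [PartialOrder α]

/-- If both alternatives fail, any other comparability between the two chains composes with a < x or
b < y to a contradiction, so they form an induced 2+2. -/
theorem TwoPlusTwoFree.lt_or_lt (h : TwoPlusTwoFree α) {a x b y : α} (hax : a < x) (hby : b < y) :
    a < y ∨ b < x := by
  by_contra hcon
  push Not at hcon
  obtain ⟨hay, hbx⟩ := hcon
  have n1 : ¬ a ≤ b := fun e => hay (e.trans_lt hby)
  have n2 : ¬ b ≤ a := fun e => hbx (e.trans_lt hax)
  have n3 : ¬ a ≤ y := fun e => by
    rcases e.lt_or_eq with e | rfl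
    · exact hay e
    · exact n2 hby.le
  have n4 : ¬ b ≤ x := fun e => by
    rcases e.lt_or_eq with e | rfl
    · exact hbx e
    · exact n1 hax.le
  have n5 : ¬ x ≤ y := fun e => n3 (hax.le.trans e)
  have n6 : ¬ y ≤ x := fun e => n4 (hby.le.trans e)
  have n7 : ¬ x ≤ b := fun e => n1 (hax.le.trans e)
  have n8 : ¬ y ≤ a := fun e => n2 (hby.le.trans e)
  have key : ∀ u v : Fin 2 ⊕ Fin 2,
      Sum.elim ![a, x] ![b, y] u ≤ Sum.elim ![a, x] ![b, y] v ↔ u ≤ v := by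
    rintro (u | u) (v | v) <;> fin_cases u <;> fin_cases v <;>
      simp [n1, n2, n3, n4, n5, n6, n7, n8, hax.le, hby.le, hax.not_ge, hby.not_ge]
  exact h.elim (OrderEmbedding.ofMapLEIff _ key)

variable [Fintype α]

open Classical in
/-- The number of elements below `x`. -/
noncomputable def downCard (x : α) : ℕ := #{z | z < x}

/-- Strict down-sets form a chain under inclusion, so their cardinalities decide inclusion. -/
theorem TwoPlusTwoFree.down_subset (h : TwoPlusTwoFree α) {x y : α}
    (hxy : downCard x ≤ downCard y) {z : α} (hz : z < x) : z < y := by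
  classical
  by_contra hzy
  have hsub : univ.filter (· < y) ⊂ univ.filter (· < x) := by
    refine ⟨fun w hw => ?_, fun hs => hzy ?_⟩
    · simp only [mem_filter, mem_univ, true_and] at hw ⊢
      exact (h.lt_or_lt hz hw).resolve_left hzy
    · have := hs (show z ∈ ({w | w < x} : Finset α) by simpa using hz)
      simpa using this
  have := card_lt_card hsub
  unfold downCard at hxy
  omega

/-- The rank of the down-set of `x` among all down-sets. -/
noncomputable def leftEnd (x : α) : ℕ :=
  #{d ∈ univ.image (downCard : α → ℕ) | d < downCard x}

theorem leftEnd_lt_iff {x y : α} : leftEnd x < leftEnd y ↔ downCard x < downCard y := by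
  constructor
  · intro h
    by_contra hcon
    refine absurd h (not_lt.2 (card_le_card fun d hd => ?_))
    simp only [mem_filter] at hd ⊢
    exact ⟨hd.1, by omega⟩
  · intro h
    refine card_lt_card ⟨fun d hd => ?_, fun hs => ?_⟩
    · simp only [mem_filter] at hd ⊢
      exact ⟨hd.1, by omega⟩
    · have := hs (show downCard x ∈ {d ∈ univ.image (downCard : α → ℕ) | d < downCard y} by
        simpa using h)
      simp at this

theorem exists_leftEnd_iff (i : ℕ) :
    (∃ x : α, leftEnd x = i) ↔ i < #(univ.image (downCard : α → ℕ)) := by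
  have hlt : ∀ x : α, leftEnd x < #(univ.image (downCard : α → ℕ)) := fun x =>
    card_lt_card ⟨filter_subset _ _, fun hs => by
      have := hs (mem_image_of_mem downCard (mem_univ x))
      simp at this⟩
  have heq : univ.image (leftEnd : α → ℕ) = range #(univ.image (downCard : α → ℕ)) := by
    refine eq_of_subset_of_card_le (fun i hi => ?_) ?_
    · obtain ⟨x, -, rfl⟩ := mem_image.1 hi
      exact mem_range.2 (hlt x)
    · rw [card_range]
      rcases isEmpty_or_nonempty α with hα | hα
      · simp [Finset.univ_eq_empty]
      choose! f hf using fun d (hd : d ∈ univ.image (downCard : α → ℕ)) => mem_image.1 hd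
      refine card_le_card_of_injOn (fun d => leftEnd (f d))
        (fun d _ => mem_coe.2 (mem_image_of_mem _ (mem_univ _))) fun d hd d' hd' hdd => ?_
      have h1 := (hf d hd).2
      have h2 := (hf d' hd').2
      rw [← h1, ← h2]
      have a1 := leftEnd_lt_iff (x := f d) (y := f d')
      have a2 := leftEnd_lt_iff (x := f d') (y := f d)
      simp only at hdd
      omega
  rw [← mem_range, ← heq]
  simp

open Classical in
/-- The largest rank of a down-set not containing `x`. -/
noncomputable def rightEnd (x : α) : ℕ := ({y | ¬ x < y} : Finset α).sup leftEnd

theorem le_rightEnd {x y : α} (h : ¬ x < y) : leftEnd y ≤ rightEnd x := by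
  classical
  exact le_sup (f := leftEnd) (by simpa using h)

theorem exists_rightEnd_eq (x : α) : ∃ y, ¬ x < y ∧ leftEnd y = rightEnd x := by
  classical
  obtain ⟨y, hy, he⟩ := exists_mem_eq_sup ({y | ¬ x < y} : Finset α) ⟨x, by simp⟩ leftEnd
  exact ⟨y, by simpa using hy, he.symm⟩

/-- Because down-sets form a chain, those not containing x are exactly the ones of rank at most
`rightEnd x`. -/
theorem TwoPlusTwoFree.isRep (h : TwoPlusTwoFree α) :
    IsRep (fun x y : α => x < y) leftEnd rightEnd #(univ.image (downCard : α → ℕ)) := by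
  have hlt : ∀ x y : α, x < y ↔ rightEnd x < leftEnd y := by
    intro x y
    constructor
    · intro hxy
      obtain ⟨z, hz, he⟩ := exists_rightEnd_eq x
      rw [← he, leftEnd_lt_iff]
      by_contra hcon
      exact hz (h.down_subset (not_lt.1 hcon) hxy)
    · intro hxy
      by_contra hcon
      exact absurd (le_rightEnd hcon) (not_le.2 hxy)
  refine ⟨fun x => le_rightEnd (lt_irrefl x), hlt, exists_leftEnd_iff, fun i => ?_⟩
  constructor
  · rintro ⟨x, rfl⟩
    obtain ⟨y, -, he⟩ := exists_rightEnd_eq x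
    exact (exists_leftEnd_iff _).1 ⟨y, he⟩
  · intro hi
    obtain ⟨y, hy⟩ := (exists_leftEnd_iff (α := α) i).2 hi
    by_cases hi' : i + 1 < #(univ.image (downCard : α → ℕ))
    · obtain ⟨y', hy'⟩ := (exists_leftEnd_iff (α := α) (i + 1)).2 hi'
      have hd : leftEnd y < leftEnd y' := by omega
      rw [leftEnd_lt_iff] at hd
      -- An x separating two consecutive down-sets has its right end at least i and less than i + 1.
      have : ∃ x, x < y' ∧ ¬ x < y := by
        classical
        by_contra hcon
        push Not at hcon
        refine absurd hd (not_lt.2 (card_le_card fun x hx => ?_))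
        simp only [mem_filter, mem_univ, true_and] at hx ⊢
        exact hcon x hx
      obtain ⟨x, h1, h2⟩ := this
      have h1' := (hlt _ _).1 h1
      have h2' := le_rightEnd h2
      exact ⟨x, by omega⟩
    -- At the top rank y itself works: its right end is a rank and is at least its left end.
    · refine ⟨y, ?_⟩
      have h1 : leftEnd y ≤ rightEnd y := le_rightEnd (lt_irrefl y)
      obtain ⟨z, -, he⟩ := exists_rightEnd_eq y
      have := (exists_leftEnd_iff _).1 ⟨z, he⟩
      omega

end Existence

/-- The strict order on intervals: one lies entirely to the left of the other. -/
@[reducible] def intervalOrder {n : ℕ} (p : Fin n → ℕ × ℕ) (hp : ∀ i, (p i).1 ≤ (p i).2) :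
    PartialOrder (Fin n) where
  le x y := x = y ∨ (p x).2 < (p y).1
  lt x y := (p x).2 < (p y).1
  le_refl x := Or.inl rfl
  le_trans x y z := by
    rintro (rfl | h1) (rfl | h2)
    · exact Or.inl rfl
    · exact Or.inr h2
    · exact Or.inr h1
    · have := hp y; exact Or.inr (by omega)
  lt_iff_le_not_ge x y := by
    have h1 := hp x
    have h2 := hp y
    constructor
    · intro h
      refine ⟨Or.inr h, ?_⟩
      rintro (rfl | h') <;> omega
    · rintro ⟨rfl | h, h'⟩
      · exact absurd (Or.inl rfl) h'
      · exact h
  le_antisymm x y := by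
    rintro (rfl | h1) (h | h2)
    · rfl
    · rfl
    · exact h.symm
    · have := hp x; have := hp y; omega

theorem twoPlusTwoFree_intervalOrder {n : ℕ} (p : Fin n → ℕ × ℕ)
    (hp : ∀ i, (p i).1 ≤ (p i).2) :
    @TwoPlusTwoFree (Fin n) (intervalOrder p hp) := by
  let _ := intervalOrder p hp
  refine ⟨fun f => ?_⟩
  have h1 : (p (f (Sum.inl 0))).2 < (p (f (Sum.inl 1))).1 :=
    f.lt_iff_lt.2 (Sum.inl_lt_inl_iff.2 (by decide))
  have h2 : (p (f (Sum.inr 0))).2 < (p (f (Sum.inr 1))).1 :=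
    f.lt_iff_lt.2 (Sum.inr_lt_inr_iff.2 (by decide))
  have h3 : ¬ (p (f (Sum.inl 0))).2 < (p (f (Sum.inr 1))).1 := fun h =>
    Sum.not_inl_lt_inr ((f.lt_iff_lt (a := Sum.inl 0) (b := Sum.inr 1)).1 h)
  have h4 : ¬ (p (f (Sum.inr 0))).2 < (p (f (Sum.inl 1))).1 := fun h =>
    Sum.not_inr_lt_inl ((f.lt_iff_lt (a := Sum.inr 0) (b := Sum.inl 1)).1 h)
  omega

theorem isRep_labeled {n : ℕ} (P : LabeledPoset n) :
    IsRep P.1.lt (@leftEnd _ P.1 _) (@rightEnd _ P.1 _) #(univ.image (@downCard _ P.1 _)) :=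
  @TwoPlusTwoFree.isRep _ P.1 _ P.2

/-- The multiset of intervals of the canonical representation. -/
noncomputable def posetIntervals {n : ℕ} (P : LabeledPoset n) : IntervalMultiset n :=
  ⟨univ.val.map fun x => (@leftEnd _ P.1 _ x, @rightEnd _ P.1 _ x), by simp,
    #(univ.image (@downCard _ P.1 _)), by
      obtain ⟨h1, -, h2, h3⟩ := isRep_labeled P
      refine ⟨?_, ?_, ?_⟩
      · intro p hp
        obtain ⟨x, -, rfl⟩ := Multiset.mem_map.1 hp
        exact h1 x
      · intro i; rw [← h2]; simp
      · intro i; rw [← h3]; simp⟩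

/-- Equal multisets allow elements with equal intervals to be matched, and intervals determine the
order. Conversely, an isomorphism pulls one representation back to the other by uniqueness. -/
theorem posetIntervals_eq_iff {n : ℕ} (P Q : LabeledPoset n) :
    posetIntervals P = posetIntervals Q ↔ Nonempty (P.1.le ≃r Q.1.le) := by
  have hP := isRep_labeled P
  have hQ := isRep_labeled Q
  constructor
  · intro h
    obtain ⟨e, he⟩ := exists_perm_of_map_eq _ _ (congrArg Subtype.val h)
    have hlt : ∀ x y, Q.1.lt (e x) (e y) ↔ P.1.lt x y := by
      intro x y
      rw [hP.2.1, hQ.2.1]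
      have h1 := congrArg Prod.snd (he x)
      have h2 := congrArg Prod.fst (he y)
      simp only at h1 h2
      rw [h1, h2]
    refine ⟨⟨e, fun {x y} => ?_⟩⟩
    have hPl : P.1.le x y ↔ x = y ∨ P.1.lt x y := @le_iff_eq_or_lt _ P.1 x y
    have hQl : Q.1.le (e x) (e y) ↔ e x = e y ∨ Q.1.lt (e x) (e y) :=
      @le_iff_eq_or_lt _ Q.1 (e x) (e y)
    rw [hPl, hQl, hlt, e.injective.eq_iff]
  · rintro ⟨e⟩
    have hlt : ∀ x y, Q.1.lt (e x) (e y) ↔ P.1.lt x y := by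
      intro x y
      rw [@lt_iff_le_not_ge _ P.1.toPreorder, @lt_iff_le_not_ge _ Q.1.toPreorder]
      exact and_congr e.map_rel_iff (not_congr e.map_rel_iff)
    have hQ' : IsRep P.1.lt (fun x => @leftEnd _ Q.1 _ (e x)) (fun x => @rightEnd _ Q.1 _ (e x))
        #(univ.image (@downCard _ Q.1 _)) := by
      have exists_comp_iff : ∀ (f : Fin n → ℕ) (i : ℕ), (∃ x, f (e x) = i) ↔ ∃ x, f x = i :=
        fun f i => ⟨fun ⟨x, hx⟩ => ⟨e x, hx⟩, fun ⟨y, hy⟩ => by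
          obtain ⟨x, rfl⟩ := e.surjective y
          exact ⟨x, hy⟩⟩
      refine ⟨fun x => hQ.1 _, fun x y => (hlt x y).symm.trans (hQ.2.1 _ _), fun i => ?_,
        fun i => ?_⟩
      · rw [← hQ.2.2.1]; exact exists_comp_iff _ i
      · rw [← hQ.2.2.2]; exact exists_comp_iff _ i
    obtain ⟨h1, h2⟩ := hP.unique hQ'
    refine Subtype.ext ?_
    simp only [posetIntervals]
    rw [h1, h2]
    have := congrArg Finset.val (Finset.map_univ_equiv e.toEquiv)
    conv_rhs => rw [← this]
    rw [Finset.map_val, Multiset.map_map]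
    rfl

/-- The given intervals represent their own interval order, so by uniqueness they are the canonical
ones. -/
theorem posetIntervals_surjective (n : ℕ) :
    Function.Surjective (posetIntervals : LabeledPoset n → IntervalMultiset n) := by
  rintro ⟨s, hs, m, hm⟩
  obtain ⟨p, rfl⟩ := exists_family_of_card s hs
  have hp : ∀ i, (p i).1 ≤ (p i).2 := fun i => hm.1 _ (Multiset.mem_map_of_mem p (mem_univ i))
  let P : LabeledPoset n := ⟨intervalOrder p hp, twoPlusTwoFree_intervalOrder p hp⟩
  refine ⟨P, Subtype.ext ?_⟩
  have hR : IsRep P.1.lt (fun x => (p x).1) (fun x => (p x).2) m := by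
    refine ⟨hp, fun x y => Iff.rfl, fun i => ?_, fun i => ?_⟩
    · rw [← hm.2.1]; simp
    · rw [← hm.2.2]; simp
  obtain ⟨h1, h2⟩ := (isRep_labeled P).unique hR
  simp only [posetIntervals]
  rw [h1, h2]

theorem card_unlabeledPoset (n : ℕ) :
    Nat.card (UnlabeledPoset n) = Nat.card (IntervalMultiset n) := by
  refine Nat.card_congr (Equiv.ofBijective
    (Quotient.lift posetIntervals fun P Q h => (posetIntervals_eq_iff P Q).2 h) ⟨?_, ?_⟩)
  · intro x y
    induction x using Quotient.inductionOn
    induction y using Quotient.inductionOn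
    intro h
    exact Quotient.sound ((posetIntervals_eq_iff _ _).1 h)
  · intro s
    obtain ⟨P, hP⟩ := posetIntervals_surjective n s
    exact ⟨Quotient.mk _ P, hP⟩

/-! ### Runs of openers and closers in a chord diagram -/

section Runs

variable {N : ℕ}

/-- Position `k` is a closer and position `k + 1` is an opener. -/
def IsTurn (π : Equiv.Perm (Fin N)) (k : ℕ) : Prop :=
  ∃ h : k + 1 < N, π ⟨k, by omega⟩ < ⟨k, by omega⟩ ∧ ⟨k + 1, h⟩ < π ⟨k + 1, h⟩

open Classical in
/-- The number of turns before position `k`. -/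
noncomputable def runIndex (π : Equiv.Perm (Fin N)) (k : ℕ) : ℕ :=
  ∑ j ∈ range k, if IsTurn π j then 1 else 0

theorem runIndex_zero (π : Equiv.Perm (Fin N)) : runIndex π 0 = 0 := by simp [runIndex]

open Classical in
theorem runIndex_succ (π : Equiv.Perm (Fin N)) (k : ℕ) :
    runIndex π (k + 1) = runIndex π k + if IsTurn π k then 1 else 0 := by
  rw [runIndex, runIndex, sum_range_succ]

theorem runIndex_mono (π : Equiv.Perm (Fin N)) : Monotone (runIndex π) := by
  classical
  exact monotone_nat_of_le_succ fun k => by rw [runIndex_succ]; omega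

/-- Between a closer and a later opener, some closer is immediately followed by an opener. -/
theorem runIndex_lt_of_closer_of_opener (π : Equiv.Perm (Fin N)) (hfix : ∀ i, π i ≠ i) {i : Fin N}
    (hi : π i < i) : ∀ (k : ℕ) (hk : k < N), (i : ℕ) < k → ⟨k, hk⟩ < π ⟨k, hk⟩ →
      runIndex π i < runIndex π k := by
  classical
  intro k
  induction k with
  | zero => intro _ h; omega
  | succ k ih =>
    intro hk hik hop
    rw [runIndex_succ]
    rcases lt_or_gt_of_ne (hfix ⟨k, by omega⟩) with hcl | hop'
    · rw [if_pos ⟨hk, hcl, hop⟩]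
      have := runIndex_mono π (show (i : ℕ) ≤ k by omega)
      omega
    · have hne : (i : ℕ) ≠ k := by
        rintro rfl
        exact absurd hi hop'.not_gt
      have := ih (by omega) (by omega) hop'
      omega

/-- Regularity permits a descent only from an opener to a closer, and equality of run indices
excludes closers before k in this range; hence π increases step by step. -/
theorem IsRegularChordDiagram.opener_lt {π : Equiv.Perm (Fin N)} (h : IsRegularChordDiagram π)
    {i : Fin N} : ∀ (k : ℕ) (hk : k < N), (i : ℕ) < k → ⟨k, hk⟩ < π ⟨k, hk⟩ →
      runIndex π i = runIndex π k → π i < π ⟨k, hk⟩ := by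
  intro k
  induction k with
  | zero => intro _ h; omega
  | succ k ih =>
    intro hk hik hop hrun
    have hop' : (⟨k, by omega⟩ : Fin N) < π ⟨k, by omega⟩ := by
      rcases lt_or_gt_of_ne (h.2.1 ⟨k, by omega⟩) with hcl | hop'
      · have h1 := runIndex_lt_of_closer_of_opener π h.2.1 hcl (k + 1) hk (by simp) hop
        have h2 := runIndex_mono π (show (i : ℕ) ≤ k by omega)
        simp only at h1
        omega
      · exact hop'
    have hstep : π ⟨k, by omega⟩ < π ⟨k + 1, hk⟩ := by
      rcases lt_trichotomy (π ⟨k, by omega⟩) (π ⟨k + 1, hk⟩) with hlt | heq | hgt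
      · exact hlt
      · have := congrArg Fin.val (π.injective heq)
        simp at this
      · have h1 := (h.2.2 ⟨k, by omega⟩ ⟨k + 1, hk⟩ rfl hgt).2
        rw [Fin.lt_def] at hop
        rw [Fin.le_def] at h1
        simp only at h1 hop
        omega
    rcases Nat.lt_or_ge (i : ℕ) k with hlt | hge
    · have h2 := runIndex_mono π (show (i : ℕ) ≤ k by omega)
      have h3 := runIndex_mono π (Nat.le_succ k)
      exact (ih (by omega) hlt hop' (by simp only [Nat.succ_eq_add_one] at h3; omega)).trans hstep
    · have : i = ⟨k, by omega⟩ := Fin.ext (by simp only; omega)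
      rw [this]; exact hstep

theorem IsRegularChordDiagram.closer_lt {π : Equiv.Perm (Fin N)} (h : IsRegularChordDiagram π)
    {i : Fin N} (hi : π i < i) : ∀ (k : ℕ) (hk : k < N), (i : ℕ) < k → π ⟨k, hk⟩ < ⟨k, hk⟩ →
      runIndex π i = runIndex π k → π i < π ⟨k, hk⟩ := by
  intro k
  induction k with
  | zero => intro _ h; omega
  | succ k ih =>
    intro hk hik hcl hrun
    have h2 := runIndex_mono π (show (i : ℕ) ≤ k by omega)
    have h3 := runIndex_mono π (Nat.le_succ k)
    simp only [Nat.succ_eq_add_one] at h3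
    have hcl' : π ⟨k, by omega⟩ < ⟨k, by omega⟩ := by
      rcases lt_or_gt_of_ne (h.2.1 ⟨k, by omega⟩) with hcl' | hop
      · exact hcl'
      · have hne : (i : ℕ) ≠ k := by
          rintro rfl
          exact absurd hi hop.not_gt
        have h1 := runIndex_lt_of_closer_of_opener π h.2.1 hi k (by omega) (by omega) hop
        omega
    have hstep : π ⟨k, by omega⟩ < π ⟨k + 1, hk⟩ := by
      rcases lt_trichotomy (π ⟨k, by omega⟩) (π ⟨k + 1, hk⟩) with hlt | heq | hgt
      · exact hlt
      · have := congrArg Fin.val (π.injective heq)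
        simp at this
      · exact absurd (h.2.2 ⟨k, by omega⟩ ⟨k + 1, hk⟩ rfl hgt).1 hcl'.not_gt
    rcases Nat.lt_or_ge (i : ℕ) k with hlt | hge
    · exact (ih (by omega) hlt hcl' (by omega)).trans hstep
    · have : i = ⟨k, by omega⟩ := Fin.ext (by simp only; omega)
      rw [this]; exact hstep

/-- Position 0 is an opener, and every turn that raises the index ends at an opener. -/
theorem exists_opener_runIndex {π : Equiv.Perm (Fin N)} (hfix : ∀ i, π i ≠ i) :
    ∀ k : ℕ, k < N → ∀ v ≤ runIndex π k, ∃ j : Fin N, j < π j ∧ runIndex π j = v := by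
  classical
  intro k
  induction k with
  | zero =>
    intro hk v hv
    rw [runIndex_zero] at hv
    refine ⟨⟨0, hk⟩, lt_of_le_of_ne (Nat.zero_le _) (hfix _).symm, ?_⟩
    simp only [runIndex_zero]
    omega
  | succ k ih =>
    intro hk v hv
    rw [runIndex_succ] at hv
    by_cases hle : v ≤ runIndex π k
    · exact ih (by omega) v hle
    · by_cases ht : IsTurn π k
      · rw [if_pos ht] at hv
        obtain ⟨h, hcl, hop⟩ := ht
        refine ⟨⟨k + 1, hk⟩, hop, ?_⟩
        simp only [runIndex_succ]
        rw [if_pos ⟨h, hcl, hop⟩]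
        omega
      · rw [if_neg ht] at hv
        omega

/-- Every turn starts at a closer of the run it ends. The inequality is strict because the current
run may not have reached its closers yet. -/
theorem exists_closer_runIndex {π : Equiv.Perm (Fin N)} :
    ∀ k : ℕ, ∀ v < runIndex π k, ∃ j : Fin N, π j < j ∧ runIndex π j = v := by
  classical
  intro k
  induction k with
  | zero => intro v hv; rw [runIndex_zero] at hv; omega
  | succ k ih =>
    intro v hv
    rw [runIndex_succ] at hv
    by_cases hle : v < runIndex π k
    · exact ih v hle
    · by_cases ht : IsTurn π k
      · rw [if_pos ht] at hv
        obtain ⟨h, hcl, -⟩ := ht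
        exact ⟨⟨k, by omega⟩, hcl, by simp only; omega⟩
      · rw [if_neg ht] at hv
        omega

end Runs

/-! ### Recovering a regular diagram from its intervals -/

/-- The label of an endpoint in the order of all endpoints: the run, then openers before closers,
then the run of the partner, then the number of the chord. The flag marks closers. -/
def endKey {n : ℕ} (p : Fin n → ℕ × ℕ) (x : Fin n × Bool) : ℕ ×ₗ ℕ ×ₗ ℕ ×ₗ ℕ :=
  toLex (if x.2 then (p x.1).2 else (p x.1).1, toLex (x.2.toNat,
    toLex (if x.2 then (p x.1).1 else (p x.1).2, (x.1 : ℕ))))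

theorem endKey_lt_iff {n : ℕ} (p : Fin n → ℕ × ℕ) (x y : Fin n × Bool) :
    endKey p x < endKey p y ↔
      (if x.2 then (p x.1).2 else (p x.1).1) < (if y.2 then (p y.1).2 else (p y.1).1) ∨
      (if x.2 then (p x.1).2 else (p x.1).1) = (if y.2 then (p y.1).2 else (p y.1).1) ∧
      (x.2.toNat < y.2.toNat ∨ x.2.toNat = y.2.toNat ∧
      ((if x.2 then (p x.1).1 else (p x.1).2) < (if y.2 then (p y.1).1 else (p y.1).2) ∨
      (if x.2 then (p x.1).1 else (p x.1).2) = (if y.2 then (p y.1).1 else (p y.1).2) ∧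
      (x.1 : ℕ) < y.1)) := by
  simp only [endKey, Prod.Lex.toLex_lt_toLex]

theorem endKey_injective {n : ℕ} (p : Fin n → ℕ × ℕ) : Function.Injective (endKey p) := by
  intro x y h
  have h1 := congrArg (fun z => (ofLex z).2) h
  have h2 := congrArg (fun z => (ofLex z).1) h1
  have h3 := congrArg (fun z => (ofLex (ofLex z).2).2) h1
  simp only [endKey, ofLex_toLex] at h2 h3
  refine Prod.ext (Fin.ext h3) ?_
  revert h2
  cases x.2 <;> cases y.2 <;> simp

theorem exists_equiv_fin_lt_iff {α β : Type*} [Fintype α] [LinearOrder β] {N : ℕ}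
    (hN : Fintype.card α = N) {f : α → β} (hf : Function.Injective f) :
    ∃ E : α ≃ Fin N, ∀ x y, E x < E y ↔ f x < f y := by
  classical
  have hc : #(univ.image f) = N := by rw [card_image_of_injective _ hf, card_univ, hN]
  let g := (univ.image f).orderIsoOfFin hc
  let E : α → Fin N := fun x => g.symm ⟨f x, mem_image_of_mem f (mem_univ x)⟩
  have hE : Function.Bijective E := by
    rw [Fintype.bijective_iff_injective_and_card, Fintype.card_fin]
    refine ⟨fun x y h => hf ?_, hN⟩
    simpa using g.symm.injective h
  refine ⟨Equiv.ofBijective E hE, fun x y => ?_⟩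
  change g.symm _ < g.symm _ ↔ _
  rw [g.symm.lt_iff_lt]
  rfl

theorem equiv_eq_of_lt_iff {α : Type*} {N : ℕ} (E E' : α ≃ Fin N)
    (h : ∀ x y, E x < E y ↔ E' x < E' y) : E = E' := by
  let f : Fin N ≃o Fin N :=
    { toEquiv := E.symm.trans E'
      map_rel_iff' := by
        intro a b
        have := h (E.symm b) (E.symm a)
        simp only [Equiv.apply_symm_apply] at this
        rw [← not_lt, ← not_lt (a := b), not_iff_not]
        exact this.symm }
  have hf : f = OrderIso.refl _ := Subsingleton.elim _ _
  ext x : 1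
  have : f (E x) = E x := by rw [hf]; rfl
  simpa [f] using this.symm

theorem eq_of_monotone_of_map_eq {n : ℕ} {β : Type*} [LinearOrder β] {f g : Fin n → β}
    (hf : Monotone f) (hg : Monotone g) (h : univ.val.map f = univ.val.map g) : f = g := by
  obtain ⟨e, he⟩ := exists_perm_of_map_eq f g h
  have he' : f = g ∘ e := funext he
  have h1 := Tuple.comp_perm_comp_sort_eq_comp_sort (f := g) (σ := e)
  rw [← he', Tuple.sort_eq_refl_iff_monotone.2 hf, Tuple.sort_eq_refl_iff_monotone.2 hg] at h1
  exact h1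

/-- The intervals of runs spanned by the chords. -/
noncomputable def chordIntervals {N : ℕ} (π : Equiv.Perm (Fin N)) : Multiset (ℕ × ℕ) :=
  ({k | k < π k} : Finset (Fin N)).val.map fun k : Fin N => (runIndex π k, runIndex π (π k))

theorem card_openers {n : ℕ} {π : Equiv.Perm (Fin (2 * n))} (hinv : ∀ i, π (π i) = i)
    (hfix : ∀ i, π i ≠ i) : #{k | k < π k} = n := by
  have h1 : #{k | k < π k} = #{k | ¬ k < π k} := by
    refine card_bij (fun k _ => π k) ?_ (fun _ _ _ _ h => π.injective h) ?_
    · intro k hk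
      simp only [mem_filter, mem_univ, true_and, hinv] at hk ⊢
      exact hk.not_gt
    · intro k hk
      simp only [mem_filter, mem_univ, true_and] at hk
      refine ⟨π k, ?_, hinv k⟩
      simp only [mem_filter, mem_univ, true_and, hinv]
      exact lt_of_le_of_ne (not_lt.1 hk) (hfix k)
  have h2 := card_filter_add_card_filter_not (s := (univ : Finset (Fin (2 * n))))
    (fun k => k < π k)
  rw [card_univ, Fintype.card_fin] at h2
  omega

theorem IsRegularChordDiagram.isIntervalMultiset {n : ℕ} {π : Equiv.Perm (Fin (2 * n))}
    (h : IsRegularChordDiagram π) : ∃ m, IsIntervalMultiset m (chordIntervals π) := by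
  have hmem : ∀ p, p ∈ chordIntervals π ↔
      ∃ k, k < π k ∧ (runIndex π k, runIndex π (π k)) = p := by
    intro p; simp [chordIntervals]
  have hle : ∀ p ∈ chordIntervals π, p.1 ≤ p.2 := by
    intro p hp
    obtain ⟨k, hk, rfl⟩ := (hmem p).1 hp
    exact runIndex_mono π hk.le
  rcases Nat.eq_zero_or_pos n with hn | hn
  · subst hn
    have h0 : chordIntervals π = 0 :=
      Multiset.eq_zero_of_forall_notMem fun p hp => by
        obtain ⟨k, -⟩ := (hmem p).1 hp
        exact absurd k.2 (by omega)
    exact ⟨0, hle, by simp [h0], by simp [h0]⟩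
  · have hlast : 2 * n - 1 < 2 * n := by omega
    have hmax : ∀ k : Fin (2 * n), runIndex π k ≤ runIndex π (2 * n - 1) := fun k =>
      runIndex_mono π (by omega)
    refine ⟨runIndex π (2 * n - 1) + 1, hle, fun i => ?_, fun i => ?_⟩
    · constructor
      · rintro ⟨p, hp, rfl⟩
        obtain ⟨k, hk, rfl⟩ := (hmem p).1 hp
        exact Nat.lt_succ_of_le (hmax k)
      · intro hi
        obtain ⟨k, hk, he⟩ := exists_opener_runIndex h.2.1 _ hlast i (by omega)
        exact ⟨_, (hmem _).2 ⟨k, hk, rfl⟩, he⟩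
    · constructor
      · rintro ⟨p, hp, rfl⟩
        obtain ⟨k, hk, rfl⟩ := (hmem p).1 hp
        exact Nat.lt_succ_of_le (hmax _)
      · intro hi
        have hcl : ∃ j : Fin (2 * n), π j < j ∧ runIndex π j = i := by
          rcases Nat.lt_or_ge i (runIndex π (2 * n - 1)) with hlt | hge
          · exact exists_closer_runIndex _ i hlt
          -- The last position can only be a closer, so it serves the last run.
          · refine ⟨⟨2 * n - 1, hlast⟩, lt_of_le_of_ne (Fin.le_def.2 ?_) (h.2.1 _), ?_⟩
            · simp only; omega
            · simp only; omega
        obtain ⟨j, hj, he⟩ := hcl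
        refine ⟨_, (hmem _).2 ⟨π j, by rw [h.1]; exact hj, rfl⟩, ?_⟩
        rw [h.1]; exact he

/-- The structure of a regular chord diagram: its endpoints are ordered by `endKey`. -/
theorem IsRegularChordDiagram.exists_equiv {n : ℕ} {π : Equiv.Perm (Fin (2 * n))}
    (h : IsRegularChordDiagram π) : ∃ (p : Fin n → ℕ × ℕ) (E : Fin n × Bool ≃ Fin (2 * n)),
      Monotone (fun i => toLex (p i)) ∧ univ.val.map p = chordIntervals π ∧
      (∀ i b, π (E (i, b)) = E (i, !b)) ∧ ∀ x y, E x < E y ↔ endKey p x < endKey p y := by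
  have hcard := card_openers h.1 h.2.1
  -- Chords are numbered by their openers from left to right, so that chords with equal intervals
  -- keep the same order at both ends.
  let a := ({k | k < π k} : Finset (Fin (2 * n))).orderEmbOfFin hcard
  have ha : ∀ i, a i < π (a i) := fun i => by
    have := orderEmbOfFin_mem _ hcard i
    exact (mem_filter.1 this).2
  let p : Fin n → ℕ × ℕ := fun i => (runIndex π (a i), runIndex π (π (a i)))
  let F : Fin n × Bool → Fin (2 * n) := fun x => if x.2 then π (a x.1) else a x.1
  have hF : Function.Bijective F := by
    rw [Fintype.bijective_iff_injective_and_card]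
    refine ⟨?_, by simp [mul_comm]⟩
    rintro ⟨i, b⟩ ⟨j, c⟩ he
    have hi := ha i
    have hj := ha j
    cases b <;> cases c <;> simp only [F, if_true, Bool.false_eq_true, if_false] at he
    · rw [a.injective he]
    · rw [he, h.1] at hi
      exact absurd hi hj.not_gt
    · rw [← he, h.1] at hj
      exact absurd hi hj.not_gt
    · rw [a.injective (π.injective he)]
  let E := Equiv.ofBijective F hF
  have hkey : ∀ x y, F x < F y → endKey p x < endKey p y := by
    rintro ⟨i, b⟩ ⟨j, c⟩ hlt
    have hrun := runIndex_mono π (Fin.le_def.1 hlt.le)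
    rw [endKey_lt_iff]
    have hi := ha i
    have hj := ha j
    cases b <;> cases c <;>
      simp only [F, p, if_true, Bool.false_eq_true, if_false, Bool.toNat_true, Bool.toNat_false]
        at hlt hrun ⊢
    · rcases hrun.lt_or_eq with hr | hr
      · exact Or.inl hr
      -- Openers of one run have partners in the same order, so the partners' runs increase weakly
      -- and the chord number breaks ties.
      · have h1 := h.opener_lt (a j) (a j).2 hlt hj hr
        have h2 := runIndex_mono π (Fin.le_def.1 h1.le)
        have h3 : i < j := a.lt_iff_lt.1 hlt
        rw [Fin.lt_def] at h3
        exact Or.inr ⟨hr, Or.inr ⟨trivial, by rw [Fin.eta] at h2; omega⟩⟩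
    · omega
    · have hcl : π (π (a i)) < π (a i) := by rw [h.1]; exact hi
      have := runIndex_lt_of_closer_of_opener π h.2.1 hcl (a j) (a j).2 hlt hj
      omega
    · rcases hrun.lt_or_eq with hr | hr
      · exact Or.inl hr
      · have hcl : π (π (a i)) < π (a i) := by rw [h.1]; exact hi
        have hcl' : π (π (a j)) < π (a j) := by rw [h.1]; exact hj
        have h1 := h.closer_lt hcl (π (a j)) (π (a j)).2 hlt hcl' hr
        rw [Fin.eta, h.1, h.1] at h1
        have h2 := runIndex_mono π (Fin.le_def.1 h1.le)
        have h3 : i < j := a.lt_iff_lt.1 h1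
        rw [Fin.lt_def] at h3
        exact Or.inr ⟨hr, Or.inr ⟨trivial, by omega⟩⟩
  have hiff : ∀ x y, F x < F y ↔ endKey p x < endKey p y := by
    refine fun x y => ⟨hkey x y, fun hlt => ?_⟩
    rcases lt_trichotomy (F x) (F y) with h1 | h1 | h1
    · exact h1
    · rw [hF.1 h1] at hlt
      exact absurd hlt (lt_irrefl _)
    · exact absurd (hkey y x h1) hlt.not_gt
  refine ⟨p, E, ?_, ?_, ?_, hiff⟩
  · intro i j hij
    rcases hij.lt_or_eq with hlt | rfl
    · have h1 := hkey (i, false) (j, false) (a.lt_iff_lt.2 hlt)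
      rw [endKey_lt_iff] at h1
      simp only [Bool.false_eq_true, if_false] at h1
      change toLex (p i) ≤ toLex (p j)
      rw [Prod.Lex.toLex_le_toLex]
      omega
    · exact le_rfl
  · have h1 : univ.map a.toEmbedding = ({k | k < π k} : Finset (Fin (2 * n))) :=
      map_orderEmbOfFin_univ _ hcard
    rw [chordIntervals, ← h1, Finset.map_val, Multiset.map_map]
    rfl
  · intro i b
    change π (F (i, b)) = F (i, !b)
    cases b <;> simp [F, h.1]

/-- The multiset determines its sorted listing p, the keys of p determine the arrangement E, and the
involution exchanges the two ends of each chord. -/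
theorem chordIntervals_injective {n : ℕ} {π π' : Equiv.Perm (Fin (2 * n))}
    (h : IsRegularChordDiagram π) (h' : IsRegularChordDiagram π')
    (he : chordIntervals π = chordIntervals π') : π = π' := by
  obtain ⟨p, E, hp, hm, hπ, hE⟩ := h.exists_equiv
  obtain ⟨p', E', hp', hm', hπ', hE'⟩ := h'.exists_equiv
  have hpp : (fun i => toLex (p i)) = fun i => toLex (p' i) := by
    refine eq_of_monotone_of_map_eq hp hp' ?_
    have := congrArg (Multiset.map toLex) (hm.trans (he.trans hm'.symm))
    rw [Multiset.map_map, Multiset.map_map] at this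
    exact this
  have hpp' : p = p' := funext fun i => toLex.injective (congrFun hpp i)
  subst hpp'
  have hEE : E = E' := equiv_eq_of_lt_iff E E' fun x y => (hE x y).trans (hE' x y).symm
  subst hEE
  ext k : 1
  obtain ⟨⟨i, b⟩, rfl⟩ := E.surjective k
  rw [hπ, hπ']

/-! ### Building a regular diagram from an interval multiset -/

section Construction

variable {n m : ℕ} {p : Fin n → ℕ × ℕ} {E : Fin n × Bool ≃ Fin (2 * n)}

/-- The run of an endpoint. -/
def endRun (p : Fin n → ℕ × ℕ) (x : Fin n × Bool) : ℕ := if x.2 then (p x.1).2 else (p x.1).1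

theorem endKey_lt_of_endRun_lt {x y : Fin n × Bool} (h : endRun p x < endRun p y) :
    endKey p x < endKey p y :=
  (endKey_lt_iff p x y).2 (Or.inl h)

theorem endKey_lt_of_opener_closer {x y : Fin n × Bool} (h : endRun p x = endRun p y)
    (hx : x.2 = false) (hy : y.2 = true) : endKey p x < endKey p y :=
  (endKey_lt_iff p x y).2 (Or.inr ⟨h, Or.inl (by rw [hx, hy]; decide)⟩)

theorem endRun_le_of_lt (hE : ∀ x y, E x < E y ↔ endKey p x < endKey p y) {x y : Fin n × Bool}
    (h : E x < E y) : endRun p x ≤ endRun p y := by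
  rw [hE, endKey_lt_iff] at h
  unfold endRun
  omega

/-- The chord diagram with endpoints arranged by `E`. -/
def diagram (E : Fin n × Bool ≃ Fin (2 * n)) : Equiv.Perm (Fin (2 * n)) :=
  (E.symm.trans ((Equiv.refl _).prodCongr Equiv.boolNot)).trans E

theorem diagram_apply (E : Fin n × Bool ≃ Fin (2 * n)) (x : Fin n × Bool) :
    diagram E (E x) = E (x.1, !x.2) := by
  simp [diagram, Equiv.boolNot, Prod.map]

theorem lt_diagram_iff (hle : ∀ i, (p i).1 ≤ (p i).2)
    (hE : ∀ x y, E x < E y ↔ endKey p x < endKey p y) (x : Fin n × Bool) :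
    (E x < diagram E (E x) ↔ x.2 = false) ∧ (diagram E (E x) < E x ↔ x.2 = true) := by
  have key : ∀ i, E (i, false) < E (i, true) := by
    intro i
    rw [hE, endKey_lt_iff]
    have := hle i
    simp only [Bool.false_eq_true, if_false, if_true, Bool.toNat_true, Bool.toNat_false]
    rcases this.lt_or_eq with h | h
    · exact Or.inl h
    · exact Or.inr ⟨h, Or.inl (by omega)⟩
  obtain ⟨i, b⟩ := x
  rw [diagram_apply]
  cases b
  · simp [key i, (key i).not_gt]
  · simp [key i, (key i).not_gt]

/-- Between consecutive endpoints the run grows exactly at the turns. -/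
theorem endRun_consecutive (hL : ∀ i, (∃ k, (p k).1 = i) ↔ i < m)
    (hR : ∀ i, (∃ k, (p k).2 = i) ↔ i < m) (hE : ∀ x y, E x < E y ↔ endKey p x < endKey p y)
    {x y : Fin n × Bool} (hxy : (E y : ℕ) = E x + 1) :
    endRun p y = endRun p x + if x.2 = true ∧ y.2 = false then 1 else 0 := by
  have hno : ∀ z, ¬ (endKey p x < endKey p z ∧ endKey p z < endKey p y) := by
    rintro z ⟨h1, h2⟩
    rw [← hE, Fin.lt_def] at h1 h2
    omega
  have hlt : E x < E y := Fin.lt_def.2 (by omega)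
  have hle := endRun_le_of_lt hE hlt
  have hm : ∀ z, endRun p z < m := by
    rintro ⟨i, b⟩
    cases b
    · exact (hL _).1 ⟨i, rfl⟩
    · exact (hR _).1 ⟨i, rfl⟩
  have hopen : ∀ i < m, ∃ z : Fin n × Bool, z.2 = false ∧ endRun p z = i := fun i hi => by
    obtain ⟨k, hk⟩ := (hL i).2 hi
    exact ⟨(k, false), rfl, hk⟩
  have hclose : ∀ i < m, ∃ z : Fin n × Bool, z.2 = true ∧ endRun p z = i := fun i hi => by
    obtain ⟨k, hk⟩ := (hR i).2 hi
    exact ⟨(k, true), rfl, hk⟩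
  cases hx : x.2
  · rw [if_neg (by simp)]
    by_contra hne
    obtain ⟨z, hz, he⟩ := hclose _ (hm x)
    exact hno z ⟨endKey_lt_of_opener_closer he.symm hx hz, endKey_lt_of_endRun_lt (by omega)⟩
  · cases hy : y.2
    · rw [if_pos ⟨rfl, rfl⟩]
      have hne : endRun p x ≠ endRun p y := by
        intro h
        exact absurd (endKey_lt_of_opener_closer h.symm hy hx) ((hE _ _).1 hlt).not_gt
      by_contra hcon
      obtain ⟨z, hz, he⟩ := hopen (endRun p x + 1) (by have := hm y; omega)
      exact hno z ⟨endKey_lt_of_endRun_lt (by omega), endKey_lt_of_endRun_lt (by omega)⟩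
    · rw [if_neg (by simp)]
      by_contra hne
      obtain ⟨z, hz, he⟩ := hopen _ (hm y)
      exact hno z ⟨endKey_lt_of_endRun_lt (by omega), endKey_lt_of_opener_closer he hz hy⟩

theorem runIndex_diagram (hle : ∀ i, (p i).1 ≤ (p i).2) (hL : ∀ i, (∃ k, (p k).1 = i) ↔ i < m)
    (hR : ∀ i, (∃ k, (p k).2 = i) ↔ i < m) (hE : ∀ x y, E x < E y ↔ endKey p x < endKey p y) :
    ∀ (k : ℕ) (x : Fin n × Bool), (E x : ℕ) = k → runIndex (diagram E) k = endRun p x := by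
  classical
  intro k
  induction k with
  | zero =>
    intro x hx
    rw [runIndex_zero]
    by_contra hne
    have hm : 0 < m := by
      rcases x with ⟨i, b⟩
      have := (hL _).1 ⟨i, rfl⟩
      omega
    obtain ⟨j, hj⟩ := (hL 0).2 hm
    have : E (j, false) < E x := by
      rw [hE]
      exact endKey_lt_of_endRun_lt (by
        have : endRun p (j, false) = 0 := hj
        omega)
    rw [Fin.lt_def] at this
    omega
  | succ k ih =>
    intro y hy
    have hk : k + 1 < 2 * n := by have := (E y).2; omega
    obtain ⟨x, hx⟩ := E.surjective ⟨k, by omega⟩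
    have hx' : (E x : ℕ) = k := by rw [hx]
    have hy' : E y = ⟨k + 1, hk⟩ := Fin.ext hy
    rw [runIndex_succ, ih x hx', endRun_consecutive hL hR hE (show (E y : ℕ) = E x + 1 by omega)]
    congr 1
    refine if_congr ?_ rfl rfl
    rw [← (lt_diagram_iff hle hE x).2, ← (lt_diagram_iff hle hE y).1, hx, hy']
    exact ⟨fun h => h.2, fun h => ⟨hk, h⟩⟩

theorem isRegularChordDiagram_diagram (hle : ∀ i, (p i).1 ≤ (p i).2)
    (hL : ∀ i, (∃ k, (p k).1 = i) ↔ i < m) (hR : ∀ i, (∃ k, (p k).2 = i) ↔ i < m)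
    (hE : ∀ x y, E x < E y ↔ endKey p x < endKey p y) : IsRegularChordDiagram (diagram E) := by
  refine ⟨fun k => ?_, fun k => ?_, fun k k' hkk hlt => ?_⟩
  · obtain ⟨x, rfl⟩ := E.surjective k
    rw [diagram_apply, diagram_apply]
    simp
  · obtain ⟨x, rfl⟩ := E.surjective k
    rw [diagram_apply]
    intro h
    simpa using congrArg Prod.snd (E.injective h)
  · obtain ⟨x, rfl⟩ := E.surjective k
    obtain ⟨y, rfl⟩ := E.surjective k'
    have hrun := endRun_consecutive hL hR hE hkk
    have hxy : endKey p x < endKey p y := (hE _ _).1 (Fin.lt_def.2 (by omega))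
    have hsame : x.2 ≠ y.2 := by
      intro hs
      rw [if_neg (by rw [hs]; simp)] at hrun
      -- Flipping both flags exchanges the first and third entries of the keys. For endpoints of the
      -- same kind and run the first entries agree, so the order persists and no descent occurs
      -- here.
      have hflip : endKey p (x.1, !x.2) < endKey p (y.1, !y.2) := by
        rw [endKey_lt_iff] at hxy ⊢
        unfold endRun at hrun
        obtain ⟨i, b⟩ := x
        obtain ⟨j, c⟩ := y
        simp only at hs
        subst hs
        cases b <;> simp at hxy hrun ⊢ <;> omega
      rw [← hE, ← diagram_apply, ← diagram_apply] at hflip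
      exact absurd hlt hflip.not_gt
    cases hx : x.2
    · cases hy : y.2
      · exact absurd (hx.trans hy.symm) hsame
      · refine ⟨(lt_diagram_iff hle hE x).1.2 hx, ?_⟩
        have := (lt_diagram_iff hle hE y).2.2 hy
        rw [Fin.lt_def] at this
        rw [Fin.le_def]
        omega
    · cases hy : y.2
      · have h1 := (lt_diagram_iff hle hE x).2.2 hx
        have h2 := (lt_diagram_iff hle hE y).1.2 hy
        rw [Fin.lt_def] at h1 h2 hlt
        omega
      · exact absurd (hx.trans hy.symm) hsame

theorem chordIntervals_diagram (hle : ∀ i, (p i).1 ≤ (p i).2)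
    (hL : ∀ i, (∃ k, (p k).1 = i) ↔ i < m) (hR : ∀ i, (∃ k, (p k).2 = i) ↔ i < m)
    (hE : ∀ x y, E x < E y ↔ endKey p x < endKey p y) :
    chordIntervals (diagram E) = univ.val.map p := by
  let f : Fin n ↪ Fin (2 * n) :=
    ⟨fun i => E (i, false), fun i j h => congrArg Prod.fst (E.injective h)⟩
  have h1 : ({k | k < diagram E k} : Finset (Fin (2 * n))) = univ.map f := by
    ext k
    obtain ⟨x, rfl⟩ := E.surjective k
    rw [mem_filter, (lt_diagram_iff hle hE x).1]
    simp only [mem_univ, true_and, mem_map]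
    constructor
    · intro hx
      exact ⟨x.1, congrArg E (Prod.ext rfl hx.symm)⟩
    · rintro ⟨i, hi⟩
      exact (congrArg Prod.snd (E.injective hi)).symm
  rw [chordIntervals, h1, Finset.map_val, Multiset.map_map]
  refine Multiset.map_congr rfl fun i _ => ?_
  change (runIndex (diagram E) (E (i, false)),
    runIndex (diagram E) (diagram E (E (i, false)))) = p i
  rw [diagram_apply, runIndex_diagram hle hL hR hE _ _ rfl, runIndex_diagram hle hL hR hE _ _ rfl]
  rfl

end Construction

theorem exists_regularChordDiagram {n m : ℕ} {s : Multiset (ℕ × ℕ)} (hn : s.card = n)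
    (hs : IsIntervalMultiset m s) :
    ∃ π : Equiv.Perm (Fin (2 * n)), IsRegularChordDiagram π ∧ chordIntervals π = s := by
  obtain ⟨p, rfl⟩ := exists_family_of_card s hn
  have hle : ∀ i, (p i).1 ≤ (p i).2 := fun i => hs.1 _ (Multiset.mem_map_of_mem p (mem_univ i))
  have hL : ∀ i, (∃ k, (p k).1 = i) ↔ i < m := fun i => by rw [← hs.2.1]; simp
  have hR : ∀ i, (∃ k, (p k).2 = i) ↔ i < m := fun i => by rw [← hs.2.2]; simp
  obtain ⟨E, hE⟩ := exists_equiv_fin_lt_iff (N := 2 * n)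
    (by rw [Fintype.card_prod, Fintype.card_fin, Fintype.card_bool, mul_comm]) (endKey_injective p)
  exact ⟨diagram E, isRegularChordDiagram_diagram hle hL hR hE,
    chordIntervals_diagram hle hL hR hE⟩

theorem card_regularChordDiagram (n : ℕ) :
    Nat.card {π : Equiv.Perm (Fin (2 * n)) // IsRegularChordDiagram π} =
      Nat.card (IntervalMultiset n) := by
  refine Nat.card_congr (Equiv.ofBijective
    (fun π => ⟨chordIntervals π.1, ?_, π.2.isIntervalMultiset⟩) ⟨?_, ?_⟩)
  · rw [chordIntervals, Multiset.card_map]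
    exact card_openers π.2.1 π.2.2.1
  · intro π π' h
    exact Subtype.ext (chordIntervals_injective π.2 π'.2 (congrArg Subtype.val h))
  · rintro ⟨s, hn, m, hs⟩
    obtain ⟨π, hπ, he⟩ := exists_regularChordDiagram hn hs
    exact ⟨⟨π, hπ⟩, Subtype.ext he⟩

/-! ### Comparison of the series -/

theorem posetSeries_eq : posetSeries = intervalSeries := by
  ext n
  simp [posetSeries, intervalSeries, card_unlabeledPoset]

theorem chordSeries_eq : chordSeries = intervalSeries := by
  ext n
  simp [chordSeries, intervalSeries, card_regularChordDiagram]

theorem eq_of_forall_X_pow_dvd_sub {f g : ℤ⟦X⟧} {u : ℕ → ℤ⟦X⟧} (hf : ∀ N, X ^ N ∣ f - u N)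
    (hg : ∀ N, X ^ N ∣ g - u N) : f = g := by
  ext n
  have h := dvd_sub (hf (n + 1)) (hg (n + 1))
  rw [sub_sub_sub_cancel_right] at h
  have := X_pow_dvd_iff.1 h n (by omega)
  rwa [map_sub, sub_eq_zero] at this

theorem treeSeries_eq_intervalSeries : 1 + X * treeSeries 0 0 = intervalSeries :=
  eq_of_forall_X_pow_dvd_sub X_pow_dvd_treeSeries_sub X_pow_dvd_intervalSeries_sub

theorem hasSum_qPoch : HasSum qPoch intervalSeries := by
  rw [PowerSeries.WithPiTopology.hasSum_iff_hasSum_coeff]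
  intro n
  have h1 : coeff n intervalSeries = ∑ k ∈ range (n + 1), coeff n (qPoch k) := by
    have := X_pow_dvd_iff.1 (X_pow_dvd_intervalSeries_sub (n + 1)) n (by omega)
    rwa [map_sub, sub_eq_zero, map_sum] at this
  rw [h1]
  refine hasSum_sum_of_ne_finset_zero fun k hk => ?_
  exact X_pow_dvd_iff.1 (X_pow_dvd_qPoch k) n (by simpa using hk)

end Fishburn

/-- Convergence of the sum is that of formal power series: coefficientwise, with `ℤ` discrete. -/
theorem theorem6p1 :
    HasSum
      (fun n : ℕ => ∏ i ∈ Finset.Icc 1 n, (1 - (1 - (PowerSeries.X : PowerSeries ℤ)) ^ i))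
      Fishburn.posetSeries ∧
    Fishburn.ascentSeries = Fishburn.posetSeries ∧
    Fishburn.permSeries = Fishburn.posetSeries ∧
    Fishburn.chordSeries = Fishburn.posetSeries := by
  rw [Fishburn.posetSeries_eq, Fishburn.ascentSeries_eq, Fishburn.permSeries_eq,
    Fishburn.chordSeries_eq, Fishburn.treeSeries_eq_intervalSeries]
  exact ⟨Fishburn.hasSum_qPoch, rfl, rfl, rfl⟩
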